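/- All vector spaces and tensor products are over $\mathbb{C}$. A \emph{braided quantum group} $G=(\mathcal A,\{\phi,\epsilon,\kappa,\sigma\})$ consists of a unital associative complex algebra $\mathcal A$ with product $m\colon\mathcal A\otimes\mathcal A\to\mathcal A$ and unit $1$, a coassociative coproduct $\phi\colon\mathcal A\to\mathcal A\otimes\mathcal A$ with counit $\epsilon\colon\mathcal A\to\mathbb C$, and bijective linear maps $\kappa\colon\mathcal A\to\mathcal A$ and $\sigma\colon\mathcal A\otimes\mathcal A\to\mathcal A\otimes\mathcal A$ such that \begin{align*} \sigma(m\otimes\mathrm{id})&=(\mathrm{id}\otimes m)(\sigma\otimes\mathrm{id})(\mathrm{id}\otimes\sigma),\\ \sigma(\mathrm{id}\otimes m)&=(m\otimes\mathrm{id})(\mathrm{id}\otimes\sigma)(\sigma\otimes\mathrm{id}),\\ \phi m&=(m\otimes m)(\mathrm{id}\otimes\sigma\otimes\mathrm{id})(\phi\otimes\phi),\\ (\sigma\otimes\mathrm{id}^2)(\mathrm{id}\otimes\phi\otimes\mathrm{id})(\sigma^{-1}\otimes\mathrm{id})(\mathrm{id}\otimes\phi)&=(\mathrm{id}^2\otimes\sigma)(\mathrm{id}\otimes\phi\otimes\mathrm{id})(\mathrm{id}\otimes\sigma^{-1})(\phi\otimes\mathrm{id}),\\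 m(\mathrm{id}\otimes\kappa)\phi&=m(\kappa\otimes\mathrm{id})\phi=1\epsilon . \end{align*} Proposition. Let $G=(\mathcal A,\{\phi,\epsilon,\kappa,\sigma\})$ be a braided quantum group, and define $$\tau=(\mathrm{id}^2\otimes\epsilon)(\mathrm{id}\otimes\sigma^{-1})(\phi\otimes\mathrm{id})\sigma\colon\mathcal A\otimes\mathcal A\to\mathcal A\otimes\mathcal A .$$ Then $\tau$ is bijective. For each $n\in\mathbb Z$ put $$\sigma_n=(\sigma\tau^{-1})^{n-1}\sigma,\qquad m_n=m\sigma_n^{-1}\sigma,\qquad \kappa_n=(\epsilon\otimes\kappa)\sigma_n^{-1}\sigma\phi .$$ Then for every $n\in\mathbb Z$ one also has $\kappa_n=(\kappa\otimes\epsilon)\sigma_n^{-1}\sigma\phi$, and, if $\mathcal A_n$ denotes the vector space $\mathcal A$ with the product $m_n$ and the unit $1$, then $G_n=(\mathcal A_n,\{\phi,\epsilon,\kappa_n,\sigma_n\})$ is a braided quantum group. In particular, $G_0$ has braiding $\sigma_0=\tau$, and its counit is multiplicative: $\epsilon m_0=\epsilon\otimes\epsilon$. -/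

import Mathlib

open scoped TensorProduct

noncomputable section

namespace BraidedQG

variable {A : Type*} [AddCommGroup A] [Module ℂ A]

/-- `f ⊗ id` acting on the first two factors of `A ⊗ (A ⊗ W)`, for `f : A ⊗ A → A ⊗ A`. -/
def onFirstTwo (W : Type*) [AddCommGroup W] [Module ℂ W] (f : A ⊗[ℂ] A →ₗ[ℂ] A ⊗[ℂ] A) :
    A ⊗[ℂ] (A ⊗[ℂ] W) →ₗ[ℂ] A ⊗[ℂ] (A ⊗[ℂ] W) :=
  (TensorProduct.assoc ℂ A A W).toLinearMap ∘ₗ f.rTensor W ∘ₗ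
    (TensorProduct.assoc ℂ A A W).symm.toLinearMap

/-- `m ⊗ id : A ⊗ (A ⊗ A) → A ⊗ A`. -/
def mulLeft (m : A ⊗[ℂ] A →ₗ[ℂ] A) : A ⊗[ℂ] (A ⊗[ℂ] A) →ₗ[ℂ] A ⊗[ℂ] A :=
  m.rTensor A ∘ₗ (TensorProduct.assoc ℂ A A A).symm.toLinearMap

/-- `φ ⊗ id : A ⊗ A → A ⊗ (A ⊗ A)`. -/
def comulLeft (φ : A →ₗ[ℂ] A ⊗[ℂ] A) : A ⊗[ℂ] A →ₗ[ℂ] A ⊗[ℂ] (A ⊗[ℂ] A) :=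
  (TensorProduct.assoc ℂ A A A).toLinearMap ∘ₗ φ.rTensor A

/-- `id ⊗ f ⊗ id` acting on the two middle factors of `(A ⊗ A) ⊗ (A ⊗ A)`. -/
def onMiddle (f : A ⊗[ℂ] A →ₗ[ℂ] A ⊗[ℂ] A) :
    (A ⊗[ℂ] A) ⊗[ℂ] (A ⊗[ℂ] A) →ₗ[ℂ] (A ⊗[ℂ] A) ⊗[ℂ] (A ⊗[ℂ] A) :=
  (TensorProduct.assoc ℂ A A (A ⊗[ℂ] A)).symm.toLinearMap ∘ₗ
    (onFirstTwo A f).lTensor A ∘ₗ (TensorProduct.assoc ℂ A A (A ⊗[ℂ] A)).toLinearMap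

/-- `(A, {φ, ε, κ, σ})` is a braided quantum group, where the complex vector space `A` carries the
product `m` and the unit element `one`. The structure maps are explicit arguments because several
products on one vector space are considered. -/
structure IsBraidedQuantumGroup (m : A ⊗[ℂ] A →ₗ[ℂ] A) (one : A) (φ : A →ₗ[ℂ] A ⊗[ℂ] A)
    (ε : A →ₗ[ℂ] ℂ) (κ : A →ₗ[ℂ] A) (σ : A ⊗[ℂ] A ≃ₗ[ℂ] A ⊗[ℂ] A) : Prop where
  /-- `m (m ⊗ id) = m (id ⊗ m)` -/
  mul_assoc : m ∘ₗ mulLeft m = m ∘ₗ m.lTensor A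
  one_mul : ∀ a : A, m (one ⊗ₜ[ℂ] a) = a
  mul_one : ∀ a : A, m (a ⊗ₜ[ℂ] one) = a
  /-- `(φ ⊗ id) φ = (id ⊗ φ) φ` -/
  coassoc : comulLeft φ ∘ₗ φ = φ.lTensor A ∘ₗ φ
  /-- `(ε ⊗ id) φ = id` -/
  counit_left : (TensorProduct.lid ℂ A).toLinearMap ∘ₗ ε.rTensor A ∘ₗ φ = LinearMap.id
  /-- `(id ⊗ ε) φ = id` -/
  counit_right : (TensorProduct.rid ℂ A).toLinearMap ∘ₗ ε.lTensor A ∘ₗ φ = LinearMap.id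
  antipode_bijective : Function.Bijective κ
  /-- `σ (m ⊗ id) = (id ⊗ m) (σ ⊗ id) (id ⊗ σ)` -/
  braiding_mul_left : σ.toLinearMap ∘ₗ mulLeft m =
    m.lTensor A ∘ₗ onFirstTwo A σ.toLinearMap ∘ₗ σ.toLinearMap.lTensor A
  /-- `σ (id ⊗ m) = (m ⊗ id) (id ⊗ σ) (σ ⊗ id)` -/
  braiding_mul_right : σ.toLinearMap ∘ₗ m.lTensor A =
    mulLeft m ∘ₗ σ.toLinearMap.lTensor A ∘ₗ onFirstTwo A σ.toLinearMap
  /-- `φ m = (m ⊗ m) (id ⊗ σ ⊗ id) (φ ⊗ φ)` -/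
  comul_mul : φ ∘ₗ m =
    TensorProduct.map m m ∘ₗ onMiddle σ.toLinearMap ∘ₗ TensorProduct.map φ φ
  /-- `(σ ⊗ id²) (id ⊗ φ ⊗ id) (σ⁻¹ ⊗ id) (id ⊗ φ) = (id² ⊗ σ) (id ⊗ φ ⊗ id) (id ⊗ σ⁻¹) (φ ⊗ id)` -/
  braiding_comul :
    onFirstTwo (A ⊗[ℂ] A) σ.toLinearMap ∘ₗ (comulLeft φ).lTensor A ∘ₗ
        onFirstTwo A σ.symm.toLinearMap ∘ₗ φ.lTensor A =
      (σ.toLinearMap.lTensor A).lTensor A ∘ₗ (comulLeft φ).lTensor A ∘ₗ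
        σ.symm.toLinearMap.lTensor A ∘ₗ comulLeft φ
  /-- `m (id ⊗ κ) φ = 1 ε` -/
  antipode_right : ∀ a : A, m (κ.lTensor A (φ a)) = ε a • one
  /-- `m (κ ⊗ id) φ = 1 ε` -/
  antipode_left : ∀ a : A, m (κ.rTensor A (φ a)) = ε a • one

/-- The secondary flip-over operator `τ = (id² ⊗ ε) (id ⊗ σ⁻¹) (φ ⊗ id) σ`. -/
def secondaryFlip (φ : A →ₗ[ℂ] A ⊗[ℂ] A) (ε : A →ₗ[ℂ] ℂ) (σ : A ⊗[ℂ] A ≃ₗ[ℂ] A ⊗[ℂ] A) :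
    A ⊗[ℂ] A →ₗ[ℂ] A ⊗[ℂ] A :=
  ((TensorProduct.rid ℂ A).toLinearMap ∘ₗ ε.lTensor A).lTensor A ∘ₗ
    σ.symm.toLinearMap.lTensor A ∘ₗ comulLeft φ ∘ₗ σ.toLinearMap

/-- `σₙ = (σ τ⁻¹)ⁿ⁻¹ σ` for an integer `n`; the product of linear automorphisms is composition. -/
def braidingSeq (σ τ : A ⊗[ℂ] A ≃ₗ[ℂ] A ⊗[ℂ] A) (n : ℤ) : A ⊗[ℂ] A ≃ₗ[ℂ] A ⊗[ℂ] A :=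
  (σ * τ⁻¹) ^ (n - 1) * σ

/-- `mₙ = m σₙ⁻¹ σ`. -/
def mulSeq (m : A ⊗[ℂ] A →ₗ[ℂ] A) (σ τ : A ⊗[ℂ] A ≃ₗ[ℂ] A ⊗[ℂ] A) (n : ℤ) :
    A ⊗[ℂ] A →ₗ[ℂ] A :=
  m ∘ₗ (braidingSeq σ τ n).symm.toLinearMap ∘ₗ σ.toLinearMap

/-- `κₙ = (ε ⊗ κ) σₙ⁻¹ σ φ`. -/
def antipodeSeq (φ : A →ₗ[ℂ] A ⊗[ℂ] A) (ε : A →ₗ[ℂ] ℂ) (κ : A →ₗ[ℂ] A)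
    (σ τ : A ⊗[ℂ] A ≃ₗ[ℂ] A ⊗[ℂ] A) (n : ℤ) : A →ₗ[ℂ] A :=
  (TensorProduct.lid ℂ A).toLinearMap ∘ₗ TensorProduct.map ε κ ∘ₗ
    (braidingSeq σ τ n).symm.toLinearMap ∘ₗ σ.toLinearMap ∘ₗ φ

/-- `(κ ⊗ ε) σₙ⁻¹ σ φ`. -/
def antipodeSeq' (φ : A →ₗ[ℂ] A ⊗[ℂ] A) (ε : A →ₗ[ℂ] ℂ) (κ : A →ₗ[ℂ] A)
    (σ τ : A ⊗[ℂ] A ≃ₗ[ℂ] A ⊗[ℂ] A) (n : ℤ) : A →ₗ[ℂ] A :=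
  (TensorProduct.rid ℂ A).toLinearMap ∘ₗ TensorProduct.map κ ε ∘ₗ
    (braidingSeq σ τ n).symm.toLinearMap ∘ₗ σ.toLinearMap ∘ₗ φ

end BraidedQG

end

/-!
Writing maps between tensor powers of `A` as operators on the leading strands of an unspecified
number of strands turns `f ⊗ id` into `f` and `id ⊗ f` into a shift `s f`, and the axioms of a
braided quantum group into relations in a monoid with an endomorphism `s`. All tensor powers embed
into a single such monoid, the endomorphisms of a space `W ≠ 0` with `A ⊗ W ≃ W`, provided `A ≠ 0`.

In this monoid, put `K = τ⁻¹ σ`. Applying the counit to the compatibility between `σ` and `φ` gives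
`K = (id ⊗ α ⊗ id) (φ ⊗ φ)` with `α = (ε ⊗ ε) σ`, and the multiplicativity of `φ` together with the
antipode shows that `K` is inverted by the same expression with `ε m` in place of `α`; hence `τ` is
invertible. The data at level `n` become `σₙ = τ Kⁿ`, `mₙ = μ K⁻ⁿ` with `μ = m K`, and
`κₙ = κ (ε ⊗ id) K¹⁻ⁿ φ`. So everything reduces to the case `n = 0`, that is to `τ` and `μ`, and to
how powers of `K` move past the structure maps. The decisive point is that moving `K` past `μ`
produces a twist of the first and third strands, whose two conjugates `(id ⊗ τ)⁻¹ (K ⊗ id) (id ⊗ τ)`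
and `(τ ⊗ id)⁻¹ (id ⊗ K) (τ ⊗ id)` coincide.
-/

noncomputable section

namespace BraidedQG

/-! ### The strand calculus -/

section StrandCalculus

variable {M : Type*} [Monoid M]

/-- `x` consumes the first `k` strands and produces `l` strands. The elements of `M` stand for
operators acting on finitely many of the leading strands, and `s` puts an idle strand in front, so
that `x` is `k`-to-`l` exactly if it can be exchanged with the operators on the other strands. -/
class Local (s : M →* M) (k : ℕ) (l : outParam ℕ) (x : M) : Prop where
  mul_iterate : ∀ y, x * s^[k] y = s^[l] y * x

namespace Local

variable {s : M →* M} {k l : ℕ} {x : M}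

theorem mul_iterate_mul [h : Local s k l x] (y z : M) :
    x * (s^[k] y * z) = s^[l] y * (x * z) := by
  rw [← mul_assoc, h.mul_iterate, mul_assoc]

instance shift [h : Local s k l x] : Local s (k + 1) (l + 1) (s x) where
  mul_iterate y := by
    rw [Function.iterate_succ_apply', Function.iterate_succ_apply', ← map_mul, h.mul_iterate,
      map_mul]

instance units_zpow {u : Mˣ} [h : Local s k k (u : M)] (n : ℤ) :
    Local s k k ((u ^ n : Mˣ) : M) where
  mul_iterate y := Commute.units_zpow_left (h.mul_iterate y) n

instance units_inv {u : Mˣ} [h : Local s k k (u : M)] : Local s k k ((u⁻¹ : Mˣ) : M) where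
  mul_iterate y := Commute.units_inv_left (h.mul_iterate y)

end Local

-- Kept as a single conjunction in order to be used as a simp set: `simp only [interchange s]` moves
-- the operators that act on later strands to the left and cancels units against their inverses, so
-- that words that differ by an exchange of disjoint operators get the same normal form.
theorem interchange (s : M →* M) :
    (∀ a b c : M, a * b * c = a * (b * c)) ∧ (∀ a : M, 1 * a = a) ∧ (∀ a : M, a * 1 = a) ∧
    (∀ a b : M, s (a * b) = s a * s b) ∧ s 1 = 1 ∧
    (∀ u : Mˣ, (u : M) * (u⁻¹ : Mˣ) = 1) ∧ (∀ u : Mˣ, ((u⁻¹ : Mˣ) : M) * u = 1) ∧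
    (∀ (u : Mˣ) (z : M), u * ((u⁻¹ : Mˣ) * z) = z) ∧
    (∀ (u : Mˣ) (z : M), (u⁻¹ : Mˣ) * (u * z) = z) ∧
    (∀ u : Mˣ, s u * s (u⁻¹ : Mˣ) = 1) ∧ (∀ u : Mˣ, s (u⁻¹ : Mˣ) * s u = 1) ∧
    (∀ (u : Mˣ) (z : M), s u * (s (u⁻¹ : Mˣ) * z) = z) ∧
    (∀ (u : Mˣ) (z : M), s (u⁻¹ : Mˣ) * (s u * z) = z) ∧
    (∀ (l : ℕ) (x : M) [Local s 0 l x] (y : M), x * y = s^[l] y * x) ∧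
    (∀ (l : ℕ) (x : M) [Local s 0 l x] (y z : M), x * (y * z) = s^[l] y * (x * z)) ∧
    (∀ (l : ℕ) (x : M) [Local s 1 l x] (y : M), x * s y = s^[l] y * x) ∧
    (∀ (l : ℕ) (x : M) [Local s 1 l x] (y z : M), x * (s y * z) = s^[l] y * (x * z)) ∧
    (∀ (l : ℕ) (x : M) [Local s 2 l x] (y : M), x * s (s y) = s^[l] y * x) ∧
    (∀ (l : ℕ) (x : M) [Local s 2 l x] (y z : M), x * (s (s y) * z) = s^[l] y * (x * z)) ∧
    (∀ (l : ℕ) (x : M) [Local s 3 l x] (y : M), x * s (s (s y)) = s^[l] y * x) ∧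
    (∀ (l : ℕ) (x : M) [Local s 3 l x] (y z : M),
      x * (s (s (s y)) * z) = s^[l] y * (x * z)) ∧
    (∀ (l : ℕ) (x : M) [Local s 4 l x] (y : M), x * s (s (s (s y))) = s^[l] y * x) ∧
    (∀ (l : ℕ) (x : M) [Local s 4 l x] (y z : M),
      x * (s (s (s (s y))) * z) = s^[l] y * (x * z)) ∧
    (∀ (l : ℕ) (x : M) [Local s 5 l x] (y : M), x * s (s (s (s (s y)))) = s^[l] y * x) ∧
    (∀ (l : ℕ) (x : M) [Local s 5 l x] (y z : M),
      x * (s (s (s (s (s y)))) * z) = s^[l] y * (x * z)) ∧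
    (∀ y : M, s^[0] y = y) ∧ ∀ (l : ℕ) (y : M), s^[l + 1] y = s (s^[l] y) :=
  have map_mul_inv (u : Mˣ) : s u * s (u⁻¹ : Mˣ) = 1 := by rw [← map_mul, u.mul_inv, map_one]
  have map_inv_mul (u : Mˣ) : s (u⁻¹ : Mˣ) * s u = 1 := by rw [← map_mul, u.inv_mul, map_one]
  ⟨mul_assoc, one_mul, mul_one, map_mul s, map_one s, Units.mul_inv, Units.inv_mul,
    Units.mul_inv_cancel_left, Units.inv_mul_cancel_left, map_mul_inv, map_inv_mul,
    fun u z => by rw [← mul_assoc, map_mul_inv, one_mul],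
    fun u z => by rw [← mul_assoc, map_inv_mul, one_mul],
    fun _ _ h => h.mul_iterate, fun _ _ _ => Local.mul_iterate_mul (k := 0),
    fun _ _ h => h.mul_iterate, fun _ _ _ => Local.mul_iterate_mul (k := 1),
    fun _ _ h => h.mul_iterate, fun _ _ _ => Local.mul_iterate_mul (k := 2),
    fun _ _ h => h.mul_iterate, fun _ _ _ => Local.mul_iterate_mul (k := 3),
    fun _ _ h => h.mul_iterate, fun _ _ _ => Local.mul_iterate_mul (k := 4),
    fun _ _ h => h.mul_iterate, fun _ _ _ => Local.mul_iterate_mul (k := 5),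
    fun _ => rfl, fun l y => Function.iterate_succ_apply' s l y⟩

theorem semiconjBy_map_units_inv {s : M →* M} {a : M} {u v : Mˣ} (h : SemiconjBy a u (s v)) :
    SemiconjBy a (u⁻¹ : Mˣ) (s (v⁻¹ : Mˣ)) :=
  SemiconjBy.units_inv_right (y := Units.map s v) h

theorem commute_map_units_inv {s : M →* M} {a : M} {u : Mˣ} (h : Commute a (s u)) :
    Commute a (s (u⁻¹ : Mˣ)) :=
  Commute.units_inv_right (u := Units.map s u) h

theorem semiconjBy_map_units_zpow {s : M →* M} {a : M} {u v : Mˣ} (h : SemiconjBy a u (s v))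
    (n : ℤ) : SemiconjBy a (u ^ n : Mˣ) (s (v ^ n : Mˣ)) := by
  simpa only [← map_zpow, Units.coe_map] using
    SemiconjBy.units_zpow_right (y := Units.map s v) h n

theorem commute_map_units_zpow {s : M →* M} {a : M} {u : Mˣ} (h : Commute a (s u)) (n : ℤ) :
    Commute a (s (u ^ n : Mˣ)) := by
  simpa only [← map_zpow, Units.coe_map] using
    Commute.units_zpow_right (u := Units.map s u) h n

/-- A braided quantum group in the strand calculus of `s`. Both `f ⊗ id` and `f` are represented by
the same element of `M`, and `id ⊗ f` is represented by the image of that element under `s`. -/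
structure StrandGroup (s : M →* M) where
  mul : M
  unit : M
  comul : M
  counit : M
  antipode : M
  braiding : Mˣ
  local_mul : Local s 2 1 mul
  local_unit : Local s 0 1 unit
  local_comul : Local s 1 2 comul
  local_counit : Local s 1 0 counit
  local_antipode : Local s 1 1 antipode
  local_braiding : Local s 2 2 (braiding : M)
  mul_mul : mul * mul = mul * s mul
  mul_unit : mul * unit = 1
  mul_shift_unit : mul * s unit = 1
  comul_comul : comul * comul = s comul * comul
  counit_comul : counit * comul = 1
  shift_counit_comul : s counit * comul = 1
  braiding_mul : braiding * mul = s mul * braiding * s braiding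
  braiding_shift_mul : braiding * s mul = mul * s braiding * braiding
  comul_mul : comul * mul = mul * s (s mul) * s braiding * comul * s comul
  braiding_comul :
    braiding * s comul * (braiding⁻¹ : Mˣ) * s comul =
      s (s braiding) * s comul * s (braiding⁻¹ : Mˣ) * comul
  isUnit_antipode : IsUnit antipode
  mul_shift_antipode_comul : mul * s antipode * comul = unit * counit
  mul_antipode_comul : mul * antipode * comul = unit * counit

namespace StrandGroup

attribute [instance] local_mul local_unit local_comul local_counit local_antipode local_braiding

variable {s : M →* M} (H : StrandGroup s)

local notation "m" => mul H
local notation "η" => unit H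
local notation "φ" => comul H
local notation "ε" => counit H
local notation "κ" => antipode H
local notation "σ" => Units.val (braiding H)
local notation "σ⁻¹" => Units.val (braiding H)⁻¹

theorem braiding_unit : σ * η = s η := by
  have mul_braiding_unit : s m * σ * η = 1 :=
    calc s m * σ * η = σ * m * η * σ⁻¹ := by
          simpa only [interchange s] using congrArg (· * (η * σ⁻¹)) H.braiding_mul.symm
      _ = 1 := by simpa only [interchange s] using congrArg (σ * · * σ⁻¹) H.mul_unit
  calc σ * η = s (m * s η) * σ * η := by rw [H.mul_shift_unit, map_one, one_mul]
    _ = s m * σ * η * s η := by simp only [interchange s]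
    _ = s η := by rw [mul_braiding_unit, one_mul]

theorem braiding_shift_unit : σ * s η = η := by
  have mul_braiding_unit : m * s σ * s (s η) = 1 :=
    calc m * s σ * s (s η) = σ * s m * s (s η) * σ⁻¹ := by
          simpa only [interchange s] using
            congrArg (· * (s (s η) * σ⁻¹)) H.braiding_shift_mul.symm
      _ = 1 := by
          simpa only [interchange s] using congrArg (fun w => σ * s w * σ⁻¹) H.mul_shift_unit
  calc σ * s η = m * η * σ * s η := by rw [H.mul_unit, one_mul]
    _ = m * s σ * s (s η) * η := by simp only [interchange s]
    _ = η := by rw [mul_braiding_unit, one_mul]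

theorem comul_unit : φ * η = s η * η := by
  have comul_mul_unit : m * s (s m) * s σ * (φ * η) * φ = φ := by
    have := congrArg (· * η) H.comul_mul
    simp only [mul_assoc, H.mul_unit] at this
    simpa only [interchange s] using this.symm
  have antipode_comul : s m * s (s κ) * φ * φ = s η :=
    calc s m * s (s κ) * φ * φ = s (m * s κ * φ) * φ := by
          rw [mul_assoc _ φ φ, H.comul_comul]; simp only [map_mul, mul_assoc]
      _ = s η := by
          rw [H.mul_shift_antipode_comul, map_mul, mul_assoc, H.shift_counit_comul, mul_one]
  have mul_braiding_comul_unit : m * s σ * (φ * η) = s η :=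
    calc m * s σ * (φ * η) = m * s (s (m * s η)) * s σ * (φ * η) := by
          rw [H.mul_shift_unit, map_one, map_one, mul_one]
      _ = m * s (s m) * s σ * φ * η * s η := by simp only [interchange s]
      _ = m * s (s (m * s m)) * s (s (s (s κ))) * s σ * φ * η * φ * φ := by
          rw [← antipode_comul]; simp only [interchange s]
      _ = s m * s (s κ) * (m * s (s m) * s σ * (φ * η) * φ) * φ := by
          rw [← H.mul_mul]; simp only [interchange s]
      _ = s η := by rw [comul_mul_unit, antipode_comul]
  calc φ * η = m * s η * φ * η := by rw [H.mul_shift_unit, one_mul]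
    _ = m * s (σ * s η) * φ * η := by rw [H.braiding_shift_unit]
    _ = m * s σ * (φ * η) * η := by simp only [interchange s]
    _ = s η * η := by rw [mul_braiding_comul_unit]

theorem counit_unit : ε * η = 1 :=
  calc ε * η = m * η * ε * η := by rw [H.mul_unit, one_mul]
    _ = m * ε * (s η * η) := by simp only [interchange s]
    _ = m * (ε * φ) * η := by rw [← H.comul_unit]; simp only [mul_assoc]
    _ = 1 := by rw [H.counit_comul, mul_one, H.mul_unit]

/-! ### The secondary flip -/

/-- The two-strand form `(ε ⊗ ε) σ`. -/
def form : M := ε * ε * σ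

/-- The two-strand form `ε m`. -/
def coform : M := ε * m

local notation "α" => form H
local notation "β" => coform H

instance local_form : Local s 2 0 α := ⟨fun y => by simp only [form, interchange s]⟩

instance local_coform : Local s 2 0 β := ⟨fun y => by simp only [coform, interchange s]⟩

/-- The operator `(id ⊗ x ⊗ id) (φ ⊗ φ)` on two strands, for a form `x` on two strands. -/
def twistBy (x : M) : M := s x * φ * s φ

section TwistBy

variable (x : M)

theorem twistBy_counit_mul_counit : H.twistBy (ε * ε) = 1 :=
  calc s (ε * ε) * φ * s φ = s ε * (s ε * φ) * s φ := by simp only [map_mul, mul_assoc]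
    _ = 1 := by rw [H.shift_counit_comul, mul_one, ← map_mul, H.counit_comul, map_one]

theorem twistBy_eq : H.twistBy x = s x * s (s φ) * φ := by simp only [twistBy, interchange s]

theorem counit_mul_twistBy : ε * H.twistBy x = x * s φ :=
  calc ε * (s x * φ * s φ) = x * (ε * φ) * s φ := by simp only [interchange s]
    _ = x * s φ := by rw [H.counit_comul, mul_one]

theorem semiconjBy_comul_twistBy : SemiconjBy φ (H.twistBy x) (s (H.twistBy x)) :=
  calc φ * (s x * φ * s φ) = s (s x) * (φ * φ) * s φ := by simp only [interchange s]
    _ = s (s x * φ * s φ) * φ := by rw [H.comul_comul]; simp only [interchange s]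

variable [Local s 2 0 x]

instance local_twistBy : Local s 2 2 (H.twistBy x) :=
  ⟨fun y => by simp only [twistBy, interchange s]⟩

theorem shift_counit_mul_twistBy : s ε * H.twistBy x = s x * φ :=
  calc s ε * (s x * φ * s φ) = s x * φ * s (s ε * φ) := by
        simp only [interchange s]
    _ = s x * φ := by rw [H.shift_counit_comul, map_one, mul_one]

theorem commute_shift_comul_twistBy : Commute (s φ) (H.twistBy x) :=
  calc s φ * (s x * φ * s φ) = s x * φ * s (s φ * φ) := by simp only [interchange s]
    _ = s x * φ * s φ * s φ := by rw [← H.comul_comul, map_mul]; simp only [mul_assoc]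

theorem twistBy_mul_twistBy (y : M) : H.twistBy y * H.twistBy x = H.twistBy (y * H.twistBy x) :=
  calc s y * φ * s φ * H.twistBy x = s y * (φ * H.twistBy x) * s φ := by
        rw [mul_assoc _ (s φ), (H.commute_shift_comul_twistBy x).eq]; simp only [mul_assoc]
    _ = s (y * H.twistBy x) * φ * s φ := by
        rw [(H.semiconjBy_comul_twistBy x).eq, map_mul]; simp only [mul_assoc]

end TwistBy

theorem shift_counit_mul_braiding : s ε * σ = α * s φ := by
  have counit_braiding_comul : s ε * σ * s φ * σ⁻¹ * s φ = φ :=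
    calc s ε * σ * s φ * σ⁻¹ * s φ = s ε * s (s σ) * s φ * s σ⁻¹ * φ := by
          simpa only [interchange s] using congrArg (s ε * ·) H.braiding_comul
      _ = φ := by
          simpa only [interchange s] using
            congrArg (fun w => s σ * s w * (s σ⁻¹ * φ)) H.counit_comul
  have counit_braiding : s ε * σ * s φ * σ⁻¹ = φ * s ε :=
    calc s ε * σ * s φ * σ⁻¹ = s ε * σ * s φ * σ⁻¹ * s (s ε * φ) := by
          rw [H.shift_counit_comul, map_one, mul_one]
      _ = s (s ε) * (s ε * σ * s φ * σ⁻¹ * s φ) := by simp only [interchange s]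
      _ = φ * s ε := by rw [counit_braiding_comul]; simp only [interchange s]
  calc s ε * σ = ε * (φ * s ε) * σ := by rw [← mul_assoc, H.counit_comul, one_mul]
    _ = α * s φ := by rw [← counit_braiding]; simp only [form, interchange s]

theorem counit_mul_braiding : ε * σ = s α * φ := by
  have counit_braiding_comul : s (s ε) * s (s σ) * s φ * s σ⁻¹ * φ = s φ :=
    calc s (s ε) * s (s σ) * s φ * s σ⁻¹ * φ = s (s ε) * σ * s φ * σ⁻¹ * s φ := by
          simpa only [interchange s] using congrArg (s (s ε) * ·) H.braiding_comul.symm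
      _ = s φ := by
          simpa only [interchange s] using
            congrArg (fun w => σ * s w * (σ⁻¹ * s φ)) H.shift_counit_comul
  have counit_braiding : s ε * s σ * φ * σ⁻¹ = φ * ε :=
    calc s ε * s σ * φ * σ⁻¹ = s ε * s σ * φ * σ⁻¹ * (ε * φ) := by
          rw [H.counit_comul, mul_one]
      _ = ε * (s (s ε) * s (s σ) * s φ * s σ⁻¹ * φ) := by simp only [interchange s]
      _ = φ * ε := by rw [counit_braiding_comul]; simp only [interchange s]
  calc ε * σ = s ε * (φ * ε) * σ := by rw [← mul_assoc, H.shift_counit_comul, one_mul]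
    _ = s α * φ := by rw [← counit_braiding]; simp only [form, interchange s]

theorem shift_braiding_mul_comul : s σ * φ = H.twistBy α * σ⁻¹ * s φ * σ := by
  rw [← Units.mul_inv_eq_iff_eq_mul]
  calc s σ * φ * σ⁻¹ = s σ * φ * σ⁻¹ * (ε * φ) := by rw [H.counit_comul, mul_one]
    _ = ε * σ * s φ * σ⁻¹ * s φ := by
        simpa only [interchange s] using congrArg (ε * ·) H.braiding_comul.symm
    _ = H.twistBy α * σ⁻¹ * s φ := by rw [H.counit_mul_braiding, twistBy]

theorem braiding_mul_shift_comul : σ * s φ = s (H.twistBy α) * s σ⁻¹ * φ * σ := by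
  rw [← Units.mul_inv_eq_iff_eq_mul]
  calc σ * s φ * σ⁻¹ = σ * s φ * σ⁻¹ * s (s ε * φ) := by
        rw [H.shift_counit_comul, map_one, mul_one]
    _ = s (s (s ε)) * (σ * s φ * σ⁻¹ * s φ) := by simp only [interchange s]
    _ = s (s (s ε * σ)) * s φ * s σ⁻¹ * φ := by
        rw [H.braiding_comul]; simp only [interchange s]
    _ = s (H.twistBy α) * s σ⁻¹ * φ := by
        rw [H.shift_counit_mul_braiding, twistBy_eq]; simp only [map_mul]

theorem galois_left_inv : m * s κ * s φ * (m * s φ) = 1 :=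
  calc m * s κ * s φ * (m * s φ) = m * m * s (s κ) * s (s φ * φ) := by
        simp only [interchange s]
    _ = m * s (m * s κ * φ) * s φ := by
        rw [H.mul_mul, ← H.comul_comul]; simp only [interchange s]
    _ = m * s η * s (ε * φ) := by
        rw [H.mul_shift_antipode_comul]; simp only [map_mul, mul_assoc]
    _ = 1 := by rw [H.mul_shift_unit, H.counit_comul, map_one, mul_one]

theorem galois_right_inv : s m * s κ * φ * (s m * φ) = 1 :=
  calc s m * s κ * φ * (s m * φ) = s (m * s m) * s κ * (φ * φ) := by
        simp only [interchange s]
    _ = s m * s (m * κ * φ) * φ := by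
        rw [← H.mul_mul, H.comul_comul]; simp only [map_mul, mul_assoc]
    _ = s (m * η) * (s ε * φ) := by
        rw [H.mul_antipode_comul]; simp only [map_mul, mul_assoc]
    _ = 1 := by rw [H.mul_unit, H.shift_counit_comul, map_one, mul_one]

theorem coform_mul_galois_braiding : β * s σ * φ * s φ = 1 := by
  have mul_eq : m = m * (β * s σ * φ * s φ) :=
    calc m = ε * φ * m := by rw [H.counit_comul, one_mul]
      _ = m * (β * s σ * φ * s φ) := by
          simpa only [coform, interchange s] using congrArg (ε * ·) H.comul_mul
  have galois_mul : m * s φ * (β * s σ * φ * s φ) = m * s φ :=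
    calc m * s φ * (β * s σ * φ * s φ) = m * β * s σ * φ * s (s φ * φ) := by
          simp only [interchange s]
      _ = m * (β * s σ * φ * s φ) * s φ := by rw [← H.comul_comul, map_mul]; simp only [mul_assoc]
      _ = m * s φ := by rw [← mul_eq]
  calc β * s σ * φ * s φ = m * s κ * s φ * (m * s φ) * (β * s σ * φ * s φ) := by
        rw [H.galois_left_inv, one_mul]
    _ = 1 := by rw [mul_assoc, galois_mul, H.galois_left_inv]

theorem shift_coform_mul_galois_braiding : s (s β) * s σ * φ * s φ = 1 := by
  have mul_eq : m = m * (s (s β) * s σ * φ * s φ) :=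
    calc m = s ε * φ * m := by rw [H.shift_counit_comul, one_mul]
      _ = m * (s (s β) * s σ * φ * s φ) := by
          simpa only [coform, interchange s] using congrArg (s ε * ·) H.comul_mul
  have galois_mul : s m * φ * (s (s β) * s σ * φ * s φ) = s m * φ :=
    calc s m * φ * (s (s β) * s σ * φ * s φ)
        = s m * s (s (s β)) * s (s σ) * s (s (s φ)) * (φ * φ) := by simp only [interchange s]
      _ = s (m * (s (s β) * s σ * φ * s φ)) * φ := by
          rw [H.comul_comul]; simp only [interchange s]
      _ = s m * φ := by rw [← mul_eq]
  calc s (s β) * s σ * φ * s φ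
      = s m * s κ * φ * (s m * φ) * (s (s β) * s σ * φ * s φ) := by
        rw [H.galois_right_inv, one_mul]
    _ = 1 := by rw [mul_assoc, galois_mul, H.galois_right_inv]

theorem coform_mul_shift_braiding_mul_comul : β * s σ * φ = s ε :=
  calc β * s σ * φ = β * s σ * φ * s (s ε * φ) := by
        rw [H.shift_counit_comul, map_one, mul_one]
    _ = s ε * (β * s σ * φ * s φ) := by simp only [interchange s]
    _ = s ε := by rw [H.coform_mul_galois_braiding, mul_one]

theorem coform_mul_twistBy_form : β * H.twistBy α = ε * ε := by
  have twisted : β * H.twistBy α * σ⁻¹ * s φ * σ = s ε := by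
    rw [← H.coform_mul_shift_braiding_mul_comul, mul_assoc β (s σ), H.shift_braiding_mul_comul]
    simp only [mul_assoc]
  calc β * H.twistBy α = β * H.twistBy α * σ⁻¹ * s (s ε * φ) * σ := by
        rw [H.shift_counit_comul, map_one, mul_one, mul_assoc, Units.inv_mul, mul_one]
    _ = ε * (β * H.twistBy α * σ⁻¹ * s φ * σ) := by simp only [interchange s]
    _ = ε * ε := by rw [twisted]; simp only [interchange s]

theorem twistBy_coform_mul_twistBy_form : H.twistBy β * H.twistBy α = 1 := by
  rw [twistBy_mul_twistBy, coform_mul_twistBy_form, twistBy_counit_mul_counit]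

theorem secondaryFlip_eq :
    s (s ε) * s σ⁻¹ * φ * σ = s (s β) * s φ * σ * s φ :=
  calc s (s ε) * s σ⁻¹ * φ * σ
      = s (s ε) * s (H.twistBy β * H.twistBy α) * s σ⁻¹ * φ * σ := by
        rw [twistBy_coform_mul_twistBy_form, map_one, mul_one]
    _ = s (s ε * H.twistBy β) * (s (H.twistBy α) * s σ⁻¹ * φ * σ) := by
        simp only [map_mul, mul_assoc]
    _ = s (s β) * s φ * σ * s φ := by
        rw [shift_counit_mul_twistBy, ← braiding_mul_shift_comul]; simp only [map_mul, mul_assoc]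

theorem twistBy_form_mul_secondaryFlip :
    H.twistBy α * σ⁻¹ * (s (s ε) * s σ⁻¹ * φ * σ) = 1 :=
  calc H.twistBy α * σ⁻¹ * (s (s ε) * s σ⁻¹ * φ * σ)
      = H.twistBy α * σ⁻¹ * (s (s β) * s φ * σ * s φ) := by rw [secondaryFlip_eq]
    _ = s (s β) * (H.twistBy α * σ⁻¹ * s φ * σ) * s φ := by simp only [interchange s]
    _ = 1 := by
        rw [← shift_braiding_mul_comul, ← H.shift_coform_mul_galois_braiding]; simp only [mul_assoc]

theorem twistBy_coform_eq : H.twistBy β = σ⁻¹ * (s (s ε) * s σ⁻¹ * φ * σ) :=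
  left_inv_eq_right_inv H.twistBy_coform_mul_twistBy_form
    (by rw [← mul_assoc, twistBy_form_mul_secondaryFlip])

/-- The automorphism `τ⁻¹ σ` of two strands, where `τ` is the secondary flip. -/
def twist : Mˣ where
  val := H.twistBy α
  inv := H.twistBy β
  val_inv := by rw [twistBy_coform_eq, ← mul_assoc, twistBy_form_mul_secondaryFlip]
  inv_val := H.twistBy_coform_mul_twistBy_form

/-- The secondary flip `τ`. -/
def flip : Mˣ := H.braiding * H.twist⁻¹

local notation "τ" => Units.val (flip H)
local notation "τ⁻¹" => Units.val (flip H)⁻¹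
local notation "K" => Units.val (twist H)
local notation "K⁻¹" => Units.val (twist H)⁻¹

theorem val_flip_eq_braiding_mul : τ = σ * K⁻¹ := rfl

theorem val_flip : τ = s (s ε) * s σ⁻¹ * φ * σ :=
  calc τ = σ * H.twistBy β := H.val_flip_eq_braiding_mul
    _ = s (s ε) * s σ⁻¹ * φ * σ := by rw [twistBy_coform_eq, Units.mul_inv_cancel_left]

instance local_twist : Local s 2 2 K := inferInstanceAs (Local s 2 2 (H.twistBy α))

instance local_flip : Local s 2 2 τ := ⟨fun y => by
  simp only [flip, Units.val_mul, interchange s]⟩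

theorem val_twist : K = H.twistBy α := rfl

theorem val_inv_twist : K⁻¹ = H.twistBy β := rfl

theorem braiding_eq_flip_mul_twist : H.braiding = H.flip * H.twist :=
  (inv_mul_cancel_right _ _).symm

theorem twist_mul_inv_braiding : K * σ⁻¹ = τ⁻¹ := by
  rw [braiding_eq_flip_mul_twist, mul_inv_rev, Units.val_mul, Units.mul_inv_cancel_left]

theorem semiconjBy_comul_twist : SemiconjBy φ K (s K) := H.semiconjBy_comul_twistBy α

theorem commute_shift_comul_twist : Commute (s φ) K := H.commute_shift_comul_twistBy α

theorem semiconjBy_comul_inv_twist : SemiconjBy φ K⁻¹ (s K⁻¹) :=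
  semiconjBy_map_units_inv H.semiconjBy_comul_twist

theorem commute_shift_comul_inv_twist : Commute (s φ) K⁻¹ :=
  H.commute_shift_comul_twist.units_inv_right

theorem coform_mul_twist : β * K = ε * ε := H.coform_mul_twistBy_form

theorem counit_mul_inv_flip : ε * τ⁻¹ = s ε := by
  rw [← twist_mul_inv_braiding, ← mul_assoc, Units.mul_inv_eq_iff_eq_mul]
  exact (H.counit_mul_twistBy α).trans H.shift_counit_mul_braiding.symm

theorem shift_counit_mul_inv_flip : s ε * τ⁻¹ = ε := by
  rw [← twist_mul_inv_braiding, ← mul_assoc, Units.mul_inv_eq_iff_eq_mul]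
  exact (H.shift_counit_mul_twistBy α).trans H.counit_mul_braiding.symm

theorem counit_mul_flip : ε * τ = s ε := by
  rw [← Units.eq_mul_inv_iff_mul_eq, shift_counit_mul_inv_flip]

theorem shift_counit_mul_flip : s ε * τ = ε := by
  rw [← Units.eq_mul_inv_iff_mul_eq, counit_mul_inv_flip]

theorem shift_comul_mul_braiding : s φ * σ = τ * s σ * φ :=
  calc s φ * σ = τ * (τ⁻¹ * s φ * σ) := by simp only [interchange s]
    _ = τ * s σ * φ := by
        rw [← twist_mul_inv_braiding, mul_assoc τ, H.shift_braiding_mul_comul, val_twist]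

theorem comul_mul_braiding : φ * σ = s τ * σ * s φ :=
  calc φ * σ = s τ * (s τ⁻¹ * φ * σ) := by simp only [interchange s]
    _ = s τ * σ * s φ := by
        rw [← twist_mul_inv_braiding, map_mul, mul_assoc (s τ), H.braiding_mul_shift_comul,
          val_twist]

theorem shift_comul_mul_flip : s φ * τ = τ * s τ * φ :=
  calc s φ * τ = s φ * σ * K⁻¹ := by rw [val_flip_eq_braiding_mul, mul_assoc]
    _ = τ * s σ * (φ * K⁻¹) := by rw [shift_comul_mul_braiding, mul_assoc]
    _ = τ * s τ * φ := by
        rw [H.semiconjBy_comul_inv_twist.eq, val_flip_eq_braiding_mul, map_mul]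
        simp only [mul_assoc]

theorem comul_mul_flip : φ * τ = s τ * τ * s φ :=
  calc φ * τ = φ * σ * K⁻¹ := by rw [val_flip_eq_braiding_mul, mul_assoc]
    _ = s τ * σ * (s φ * K⁻¹) := by rw [comul_mul_braiding, mul_assoc]
    _ = s τ * τ * s φ := by
        rw [H.commute_shift_comul_inv_twist.eq, val_flip_eq_braiding_mul]; simp only [mul_assoc]

theorem flip_mul_inv_braiding : τ * σ⁻¹ = H.twistBy (ε * ε * σ⁻¹) := by
  have counit_inv_braiding : s ε * σ⁻¹ = ε * ε * σ⁻¹ * s φ := by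
    rw [Units.mul_inv_eq_iff_eq_mul, ← coform_mul_shift_braiding_mul_comul, ← coform_mul_twist,
      mul_assoc β (s σ), shift_braiding_mul_comul, val_twist]
    simp only [mul_assoc]
  calc τ * σ⁻¹ = s (s ε * σ⁻¹) * φ := by rw [val_flip]; simp only [interchange s]
    _ = H.twistBy (ε * ε * σ⁻¹) := by
        rw [counit_inv_braiding]; simp only [twistBy, interchange s]

theorem semiconjBy_comul_braiding_mul_inv_flip : SemiconjBy φ (σ * τ⁻¹) (s (σ * τ⁻¹)) := by
  have : SemiconjBy φ (H.flip * H.braiding⁻¹ : Mˣ) (s (H.flip * H.braiding⁻¹ : Mˣ)) := by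
    rw [Units.val_mul, flip_mul_inv_braiding]
    exact H.semiconjBy_comul_twistBy _
  simpa only [mul_inv_rev, inv_inv, Units.val_mul] using semiconjBy_map_units_inv this

theorem commute_shift_comul_braiding_mul_inv_flip : Commute (s φ) (σ * τ⁻¹) := by
  have : Local s 2 0 (ε * ε * σ⁻¹) := ⟨fun y => by simp only [interchange s]⟩
  have : Commute (s φ) (H.flip * H.braiding⁻¹ : Mˣ) := by
    rw [Units.val_mul, flip_mul_inv_braiding]
    exact H.commute_shift_comul_twistBy _
  simpa only [mul_inv_rev, inv_inv, Units.val_mul] using this.units_inv_right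

theorem comul_mul_braiding' : φ * σ = s σ * τ * s φ :=
  calc φ * σ = φ * (σ * τ⁻¹) * τ := by simp only [interchange s]
    _ = s (σ * τ⁻¹) * (φ * τ) := by
        rw [H.semiconjBy_comul_braiding_mul_inv_flip.eq, mul_assoc]
    _ = s σ * τ * s φ := by rw [comul_mul_flip]; simp only [interchange s]

theorem shift_comul_mul_braiding' : s φ * σ = σ * s τ * φ :=
  calc s φ * σ = s φ * (σ * τ⁻¹) * τ := by simp only [interchange s]
    _ = σ * τ⁻¹ * (s φ * τ) := by
        rw [H.commute_shift_comul_braiding_mul_inv_flip.eq, mul_assoc]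
    _ = σ * s τ * φ := by rw [shift_comul_mul_flip]; simp only [interchange s]

theorem twist_mul_shift_flip_mul_comul : K * s τ * φ = s σ * φ :=
  calc K * s τ * φ = τ⁻¹ * (σ * s τ * φ) := by
        rw [braiding_eq_flip_mul_twist]; simp only [Units.val_mul, interchange s]
    _ = s σ * φ := by
        rw [← shift_comul_mul_braiding', shift_comul_mul_braiding]; simp only [interchange s]

theorem shift_twist_mul_flip_mul_shift_comul : s K * τ * s φ = σ * s φ :=
  calc s K * τ * s φ = s τ⁻¹ * (s σ * τ * s φ) := by
        rw [braiding_eq_flip_mul_twist]; simp only [Units.val_mul, interchange s]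
    _ = σ * s φ := by
        rw [← comul_mul_braiding', comul_mul_braiding]; simp only [interchange s]

/-! ### The product at level zero -/

/-- The product `m σ₀⁻¹ σ` that goes with the braiding `σ₀ = τ`. -/
def mulZero : M := m * K

local notation "μ" => mulZero H

instance local_mulZero : Local s 2 1 μ := ⟨fun y => by simp only [mulZero, interchange s]⟩

theorem counit_mul_mulZero : ε * μ = ε * ε := by
  rw [mulZero, ← mul_assoc, ← coform, coform_mul_twist]

theorem counit_mul_counit_mul_inv_twist : ε * ε * K⁻¹ = β := by
  rw [← coform_mul_twist, Units.mul_inv_cancel_right]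

theorem comul_mul_mulZero : φ * μ = μ * s (s μ) * s τ * φ * s φ :=
  calc φ * μ = m * s (s m) * (s σ * φ) * s φ * K := by
        rw [mulZero, ← mul_assoc, H.comul_mul]; simp only [mul_assoc]
    _ = m * s (s m) * K * s τ * (φ * K) * s φ := by
        rw [← twist_mul_shift_flip_mul_comul, mul_assoc _ (s φ),
          H.commute_shift_comul_twist.eq]
        simp only [mul_assoc]
    _ = m * s (s m) * K * s σ * s (s φ) * φ := by
        rw [H.semiconjBy_comul_twist.eq, braiding_eq_flip_mul_twist]
        simp only [Units.val_mul, interchange s]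
    _ = m * s (s m) * K * s (s K * τ * s φ) * φ := by
        rw [shift_twist_mul_flip_mul_shift_comul]; simp only [map_mul, mul_assoc]
    _ = μ * s (s μ) * s τ * φ * s φ := by simp only [mulZero, interchange s]

/-- The operator `(id ⊗ m) (σ ⊗ id) (id ⊗ φ)` on two strands, which lifts `μ` along `ε ⊗ id` and is
easier to move past `φ` than `μ` itself. -/
def mulLiftLeft : M := s m * σ * s φ

/-- The mirror image `(m ⊗ id) (id ⊗ σ) (φ ⊗ id)` of `mulLiftLeft`, which lifts `μ` along
`id ⊗ ε`. -/
def mulLiftRight : M := m * s σ * φ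

theorem counit_mul_mulLiftLeft : ε * H.mulLiftLeft = μ :=
  calc ε * (s m * σ * s φ) = m * (ε * σ) * s φ := by simp only [interchange s]
    _ = μ := by rw [counit_mul_braiding, mulZero, val_twist, twistBy]; simp only [mul_assoc]

theorem shift_counit_mul_mulLiftRight : s ε * H.mulLiftRight = μ :=
  calc s ε * (m * s σ * φ) = m * s (s ε * σ) * φ := by simp only [interchange s]
    _ = μ := by
        rw [shift_counit_mul_braiding, mulZero, val_twist, twistBy_eq]
        simp only [map_mul, mul_assoc]

theorem comul_mul_mulLiftLeft : φ * H.mulLiftLeft = s H.mulLiftLeft * τ * s φ :=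
  calc φ * (s m * σ * s φ) = s (s m) * (φ * σ) * s φ := by simp only [interchange s]
    _ = s (s m) * s σ * τ * s (φ * φ) := by
        rw [comul_mul_braiding']; simp only [map_mul, mul_assoc]
    _ = s (s m * σ * s φ) * τ * s φ := by rw [H.comul_comul]; simp only [interchange s]

theorem shift_comul_mul_mulLiftRight : s φ * H.mulLiftRight = H.mulLiftRight * s τ * φ :=
  calc s φ * (m * s σ * φ) = m * s (s φ * σ) * φ := by simp only [interchange s]
    _ = m * s σ * s (s τ) * (s φ * φ) := by
        rw [shift_comul_mul_braiding']; simp only [map_mul, mul_assoc]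
    _ = m * s σ * φ * s τ * φ := by rw [← H.comul_comul]; simp only [interchange s]

theorem coform_mul_counit_twist_mul_mulLiftLeft :
    β * (s ε * K) * s H.mulLiftLeft = β * s (s ε) := by
  have counit_braiding_mul : m * (ε * σ) * s σ = ε * σ * m := by
    simpa only [interchange s] using congrArg (ε * ·) H.braiding_mul.symm
  calc β * (s ε * K) * s (s m * σ * s φ) = β * (s α * φ) * s (s m * σ * s φ) := by
        rw [val_twist, shift_counit_mul_twistBy]
    _ = ε * (m * s m) * (ε * σ) * s σ * s (s φ) := by
        rw [counit_mul_braiding, coform]; simp only [interchange s]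
    _ = β * (m * (ε * σ) * s σ) * s (s φ) := by rw [← H.mul_mul, coform]; simp only [mul_assoc]
    _ = β * (ε * σ) * s φ * m := by rw [counit_braiding_mul]; simp only [interchange s]
    _ = β * K * m := by rw [counit_mul_braiding, val_twist, twistBy]; simp only [mul_assoc]
    _ = β * s (s ε) := by rw [coform_mul_twist, coform]; simp only [interchange s]

theorem coform_mul_counit_twist_mul_mulLiftRight :
    β * s (ε * K) * H.mulLiftRight = β * ε := by
  have counit_braiding_mul : m * s (s ε * σ) * σ = s ε * σ * s m := by
    simpa only [interchange s] using congrArg (s ε * ·) H.braiding_shift_mul.symm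
  calc β * s (ε * K) * (m * s σ * φ) = β * s (α * s φ) * (m * s σ * φ) := by
        rw [val_twist, counit_mul_twistBy]
    _ = ε * (m * m) * s (s (s ε * σ)) * s σ * φ := by
        rw [shift_counit_mul_braiding, coform]; simp only [interchange s]
    _ = β * s (m * s (s ε * σ) * σ) * φ := by rw [H.mul_mul, coform]; simp only [map_mul, mul_assoc]
    _ = β * s (s ε * σ) * φ * s m := by rw [counit_braiding_mul]; simp only [interchange s]
    _ = β * K * s m := by
        rw [shift_counit_mul_braiding, val_twist, twistBy_eq]; simp only [map_mul, mul_assoc]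
    _ = β * ε := by rw [coform_mul_twist, coform]; simp only [interchange s]

theorem coform_mul_shift_mulZero : β * s μ = β * s β * φ * s τ := by
  have inv_twist_mul_lift :
      K⁻¹ * s H.mulLiftLeft = s H.mulLiftLeft * s β * φ * s τ * s (s φ) :=
    calc K⁻¹ * s H.mulLiftLeft = s β * φ * s (φ * H.mulLiftLeft) := by
          rw [val_inv_twist, twistBy]; simp only [map_mul, mul_assoc]
      _ = s H.mulLiftLeft * s β * φ * s τ * s (s φ) := by
          rw [comul_mul_mulLiftLeft]; simp only [mulLiftLeft, interchange s]
  calc β * s μ = β * s (ε * H.mulLiftLeft) := by rw [counit_mul_mulLiftLeft]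
    _ = β * (s ε * K) * (K⁻¹ * s H.mulLiftLeft) := by simp only [interchange s]
    _ = β * (s ε * K) * s H.mulLiftLeft * (s β * φ * s τ * s (s φ)) := by
        rw [inv_twist_mul_lift]; simp only [mul_assoc]
    _ = β * s β * φ * s τ * s (s (s ε * φ)) := by
        rw [coform_mul_counit_twist_mul_mulLiftLeft]; simp only [interchange s]
    _ = β * s β * φ * s τ := by rw [H.shift_counit_comul, map_one, map_one, mul_one]

theorem coform_mul_mulZero : β * μ = β * s β * s (s φ) * τ := by
  have inv_twist_mul_lift :
      s K⁻¹ * H.mulLiftRight = H.mulLiftRight * s (s β) * s (s (s φ)) * s τ * φ :=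
    calc s K⁻¹ * H.mulLiftRight = s (s β) * s (s (s φ)) * (s φ * H.mulLiftRight) := by
          rw [val_inv_twist, twistBy_eq]; simp only [map_mul, mul_assoc]
      _ = H.mulLiftRight * s (s β) * s (s (s φ)) * s τ * φ := by
          rw [shift_comul_mul_mulLiftRight]; simp only [mulLiftRight, interchange s]
  calc β * μ = β * (s ε * H.mulLiftRight) := by rw [shift_counit_mul_mulLiftRight]
    _ = β * s (ε * K) * (s K⁻¹ * H.mulLiftRight) := by simp only [interchange s]
    _ = β * s (ε * K) * H.mulLiftRight * (s (s β) * s (s (s φ)) * s τ * φ) := by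
        rw [inv_twist_mul_lift]; simp only [mul_assoc]
    _ = β * s β * s (s φ) * τ * (ε * φ) := by
        rw [coform_mul_counit_twist_mul_mulLiftRight]; simp only [interchange s]
    _ = β * s β * s (s φ) * τ := by rw [H.counit_comul, mul_one]

/-- The conjugate `(id ⊗ τ)⁻¹ (τ⁻¹ σ ⊗ id) (id ⊗ τ)` of the twist, acting on the first and the third
strand. -/
def outerTwist : Mˣ := (Units.map s H.flip)⁻¹ * H.twist * Units.map s H.flip

/-- The mirror image `(τ ⊗ id)⁻¹ (id ⊗ τ⁻¹ σ) (τ ⊗ id)` of `outerTwist`. The two operators are shown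
to be equal. -/
def outerTwist' : Mˣ := H.flip⁻¹ * Units.map s H.twist * H.flip

local notation "P" => Units.val (outerTwist H)
local notation "P⁻¹" => Units.val (outerTwist H)⁻¹
local notation "Q" => Units.val (outerTwist' H)
local notation "Q⁻¹" => Units.val (outerTwist' H)⁻¹

theorem val_outerTwist : P = s τ⁻¹ * K * s τ := rfl

theorem val_inv_outerTwist : P⁻¹ = s τ⁻¹ * K⁻¹ * s τ := by
  simp only [outerTwist, mul_inv_rev, inv_inv, ← map_inv, Units.val_mul, Units.coe_map, mul_assoc]

theorem val_outerTwist' : Q = τ⁻¹ * s K * τ := rfl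

theorem val_inv_outerTwist' : Q⁻¹ = τ⁻¹ * s K⁻¹ * τ := by
  simp only [outerTwist', mul_inv_rev, inv_inv, ← map_inv, Units.val_mul, Units.coe_map, mul_assoc]

theorem inv_outerTwist_eq : P⁻¹ = s β * φ * s τ * s (s φ) :=
  calc P⁻¹ = s τ⁻¹ * (s β * φ * s (φ * τ)) := by
        rw [val_inv_outerTwist, val_inv_twist, twistBy]; simp only [map_mul, mul_assoc]
    _ = s β * φ * s τ * s (s φ) := by rw [comul_mul_flip]; simp only [interchange s]

theorem inv_outerTwist'_eq : Q⁻¹ = s (s β) * s (s (s φ)) * s τ * φ :=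
  calc Q⁻¹ = τ⁻¹ * (s (s β) * s (s (s φ)) * (s φ * τ)) := by
        rw [val_inv_outerTwist', val_inv_twist, twistBy]; simp only [interchange s]
    _ = s (s β) * s (s (s φ)) * s τ * φ := by rw [shift_comul_mul_flip]; simp only [interchange s]

theorem inv_twist_mul_shift_mulZero : K⁻¹ * s μ = s μ * (K⁻¹ * P⁻¹) :=
  calc K⁻¹ * s μ = s β * φ * s (φ * μ) := by
        rw [val_inv_twist, twistBy]; simp only [map_mul, mul_assoc]
    _ = s (β * s μ) * φ * s (s (s μ)) * s (s τ) * s φ * s (s φ) := by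
        rw [comul_mul_mulZero]; simp only [interchange s]
    _ = s μ * s β * s (s β) * s φ * φ * s (τ * s τ * φ) * s (s φ) := by
        rw [coform_mul_shift_mulZero]; simp only [interchange s]
    _ = s μ * s β * s (s β) * (s φ * φ) * s (s φ) * s τ * s (s φ) := by
        rw [← shift_comul_mul_flip]; simp only [map_mul, mul_assoc]
    _ = s μ * (K⁻¹ * P⁻¹) := by
        rw [← H.comul_comul, val_inv_twist, inv_outerTwist_eq, twistBy]; simp only [interchange s]

theorem inv_twist_mul_mulZero : K⁻¹ * μ = μ * (s K⁻¹ * Q⁻¹) :=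
  calc K⁻¹ * μ = s β * s (s φ) * (φ * μ) := by
        rw [val_inv_twist, twistBy_eq]; simp only [mul_assoc]
    _ = μ * s (s (β * μ)) * s (s (s (s φ))) * s τ * φ * s φ := by
        rw [comul_mul_mulZero]; simp only [interchange s]
    _ = μ * s (s β) * s (s (s β)) * s (s (s (s φ))) * s (s (s (s φ))) *
          s (s τ * τ * s φ) * φ := by
        rw [coform_mul_mulZero]; simp only [interchange s]
    _ = μ * s (s β) * s (s (s β)) * s (s (s (s (s φ * φ)))) * s φ * s τ * φ := by
        rw [← comul_mul_flip, ← H.comul_comul]; simp only [interchange s]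
    _ = μ * (s K⁻¹ * Q⁻¹) := by
        rw [val_inv_twist, twistBy_eq, inv_outerTwist'_eq]; simp only [interchange s]

theorem commute_twistBy_shift {x y : M} [Local s 2 0 x] [Local s 2 2 y]
    (hy : SemiconjBy φ y (s y)) : Commute (H.twistBy x) (s y) :=
  calc H.twistBy x * s y = s x * φ * s (φ * y) := by
        simp only [twistBy, map_mul, mul_assoc]
    _ = s y * H.twistBy x := by rw [hy.eq]; simp only [twistBy, interchange s]

theorem commute_shift_twistBy {x y : M} [Local s 2 0 x] [Local s 2 2 y]
    (hy : Commute (s φ) y) : Commute (s (H.twistBy x)) y :=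
  calc s (H.twistBy x) * y = s (s x) * (s φ * y) * s (s φ) := by
        simp only [twistBy, interchange s]
    _ = y * s (H.twistBy x) := by rw [hy.eq]; simp only [twistBy, interchange s]

theorem commute_twist_shift_twist : Commute K (s K) :=
  H.commute_twistBy_shift H.semiconjBy_comul_twist

theorem commute_outerTwist_shift_twist : Commute P (s K) := by
  have : Local s 2 2 (σ * τ⁻¹) := ⟨fun y => by simp only [interchange s]⟩
  have commute_conj : Commute K (s (σ * τ⁻¹)) :=
    H.commute_twistBy_shift H.semiconjBy_comul_braiding_mul_inv_flip
  calc P * s K = s τ⁻¹ * (K * s (σ * τ⁻¹)) * s τ := by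
        rw [val_outerTwist, braiding_eq_flip_mul_twist]
        simp only [Units.val_mul, interchange s]
    _ = s K * P := by
        rw [commute_conj.eq, val_outerTwist, braiding_eq_flip_mul_twist]
        simp only [Units.val_mul, interchange s]

theorem commute_outerTwist'_twist : Commute Q K := by
  have : Local s 2 2 (σ * τ⁻¹) := ⟨fun y => by simp only [interchange s]⟩
  have commute_conj : Commute (s K) (σ * τ⁻¹) :=
    H.commute_shift_twistBy H.commute_shift_comul_braiding_mul_inv_flip
  calc Q * K = τ⁻¹ * (s K * (σ * τ⁻¹)) * τ := by
        rw [val_outerTwist', braiding_eq_flip_mul_twist]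
        simp only [Units.val_mul, interchange s]
    _ = K * Q := by
        rw [commute_conj.eq, val_outerTwist', braiding_eq_flip_mul_twist]
        simp only [Units.val_mul, interchange s]

theorem semiconjBy_comul_outerTwist : SemiconjBy φ P (s P) := by
  refine semiconjBy_map_units_inv (u := H.outerTwist⁻¹) (v := H.outerTwist⁻¹) ?_
  calc φ * P⁻¹ = s (s β) * (φ * φ) * s τ * s (s φ) := by
        rw [inv_outerTwist_eq]; simp only [interchange s]
    _ = s P⁻¹ * φ := by rw [H.comul_comul, inv_outerTwist_eq]; simp only [interchange s]

theorem semiconjBy_comul_outerTwist' : SemiconjBy φ Q (s Q) := by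
  refine semiconjBy_map_units_inv (u := H.outerTwist'⁻¹) (v := H.outerTwist'⁻¹) ?_
  calc φ * Q⁻¹ = s (s (s β)) * s (s (s (s φ))) * s (s τ) * (φ * φ) := by
        rw [inv_outerTwist'_eq]; simp only [interchange s]
    _ = s Q⁻¹ * φ := by rw [H.comul_comul, inv_outerTwist'_eq]; simp only [interchange s]

theorem commute_shift_shift_comul_outerTwist : Commute (s (s φ)) P := by
  refine Commute.units_inv_right_iff.mp ?_
  calc s (s φ) * P⁻¹ = s β * φ * s τ * s (s (s φ * φ)) := by
        rw [inv_outerTwist_eq]; simp only [interchange s]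
    _ = P⁻¹ * s (s φ) := by rw [← H.comul_comul, inv_outerTwist_eq]; simp only [interchange s]

theorem commute_shift_shift_comul_outerTwist' : Commute (s (s φ)) Q := by
  refine Commute.units_inv_right_iff.mp ?_
  calc s (s φ) * Q⁻¹ = s (s β) * s (s (s (s φ * φ))) * s τ * φ := by
        rw [inv_outerTwist'_eq]; simp only [interchange s]
    _ = Q⁻¹ * s (s φ) := by rw [← H.comul_comul, inv_outerTwist'_eq]; simp only [interchange s]

theorem twist_mul_shift_mulZero : K * s μ = s μ * (P * K) := by
  have : SemiconjBy (s μ) (H.outerTwist * H.twist : Mˣ) K := by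
    rw [← SemiconjBy.units_inv_right_iff, mul_inv_rev]
    exact H.inv_twist_mul_shift_mulZero.symm
  exact this.eq.symm

theorem twist_mul_mulZero : K * μ = μ * (Q * s K) := by
  have : SemiconjBy μ (H.outerTwist' * Units.map s H.twist : Mˣ) K := by
    rw [← SemiconjBy.units_inv_right_iff, mul_inv_rev]
    exact H.inv_twist_mul_mulZero.symm
  exact this.eq.symm

theorem mul_eq_mulZero_mul_inv_twist : m = μ * K⁻¹ :=
  (Units.mul_inv_cancel_right _ _).symm

theorem flip_mul_shift_mulZero_twisted :
    τ * s μ * s K⁻¹ * P = μ * s τ * P⁻¹ * τ * Q := by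
  rw [← Units.mul_left_inj H.twist]
  calc τ * s μ * s K⁻¹ * P * K = τ * (s μ * (P * K)) * s K⁻¹ := by
        rw [mul_assoc _ (s K⁻¹), ← (commute_map_units_inv H.commute_outerTwist_shift_twist).eq]
        simp only [mul_assoc]
        rw [(commute_map_units_inv H.commute_twist_shift_twist).eq]
    _ = σ * s m := by
        rw [← twist_mul_shift_mulZero, mul_eq_mulZero_mul_inv_twist, braiding_eq_flip_mul_twist]
        simp only [Units.val_mul, map_mul, mul_assoc]
    _ = μ * K⁻¹ * s σ * σ := by
        rw [H.braiding_shift_mul, ← mul_eq_mulZero_mul_inv_twist]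
    _ = μ * s τ * P⁻¹ * τ * Q * K := by
        rw [val_inv_outerTwist, val_outerTwist', braiding_eq_flip_mul_twist]
        simp only [Units.val_mul, interchange s]

theorem coform_mul_shift_flip_mul_flip : β * s τ * τ = s β := by
  have coform_mul : β * s τ * τ = s β * (P * Q⁻¹) :=
    calc β * s τ * τ = ε * (μ * s τ * P⁻¹ * τ * Q) * Q⁻¹ := by
          rw [← counit_mul_counit_mul_inv_twist, ← counit_mul_mulZero, val_inv_outerTwist]
          simp only [interchange s]
      _ = (ε * τ) * s (μ * K⁻¹) * P * Q⁻¹ := by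
          rw [← flip_mul_shift_mulZero_twisted]; simp only [map_mul, mul_assoc]
      _ = s β * (P * Q⁻¹) := by
          rw [counit_mul_flip, ← mul_eq_mulZero_mul_inv_twist, coform, map_mul, mul_assoc]
  have comul_mul : φ * (P * Q⁻¹) = s (P * Q⁻¹) * φ := by
    rw [map_mul]
    exact H.semiconjBy_comul_outerTwist.mul_right
      (semiconjBy_map_units_inv H.semiconjBy_comul_outerTwist')
  have counit_mul : ε * (β * s τ * τ) = β * ε :=
    calc ε * (β * s τ * τ) = β * s (s ε * τ) * τ := by simp only [interchange s]
      _ = β * ε := by rw [shift_counit_mul_flip, mul_assoc, shift_counit_mul_flip]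
  calc β * s τ * τ = s ε * φ * (β * s τ * τ) := by rw [H.shift_counit_comul, one_mul]
    _ = s ε * s (s β) * (φ * (P * Q⁻¹)) := by rw [coform_mul]; simp only [interchange s]
    _ = s (ε * (β * s τ * τ)) * φ := by rw [comul_mul, coform_mul]; simp only [map_mul, mul_assoc]
    _ = s β := by rw [counit_mul, map_mul, mul_assoc, H.shift_counit_comul, mul_one]

theorem inv_twist_mul_shift_flip_mul_flip : K⁻¹ * s τ * τ = s τ * τ * s K⁻¹ :=
  calc K⁻¹ * s τ * τ = s β * φ * s (φ * τ) * τ := by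
        rw [val_inv_twist, twistBy]; simp only [map_mul, mul_assoc]
    _ = s β * s (s (s τ)) * s (s τ) * φ * τ * s (s φ) := by
        rw [comul_mul_flip]; simp only [interchange s]
    _ = s τ * s (β * s τ * τ) * τ * s φ * s (s φ) := by
        rw [mul_assoc _ φ τ, comul_mul_flip]; simp only [interchange s]
    _ = s τ * τ * s K⁻¹ := by
        rw [coform_mul_shift_flip_mul_flip, val_inv_twist, twistBy]; simp only [interchange s]

theorem inv_outerTwist_mul_flip : P⁻¹ * τ = τ * s K⁻¹ :=
  calc P⁻¹ * τ = s τ⁻¹ * (K⁻¹ * s τ * τ) := by rw [val_inv_outerTwist]; simp only [mul_assoc]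
    _ = τ * s K⁻¹ := by rw [inv_twist_mul_shift_flip_mul_flip]; simp only [interchange s]

theorem outerTwist_eq_outerTwist' : H.outerTwist = H.outerTwist' := by
  have counit_mul_mul : ε * s m * P = ε * s m * Q :=
    calc ε * s m * P = s ε * τ * s m * P := by rw [shift_counit_mul_flip]
      _ = s ε * (τ * s μ * s K⁻¹ * P) := by
          rw [mul_eq_mulZero_mul_inv_twist]; simp only [map_mul, mul_assoc]
      _ = s ε * (μ * s τ * (P⁻¹ * τ) * Q) := by
          rw [flip_mul_shift_mulZero_twisted]; simp only [mul_assoc]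
      _ = μ * s (s ε * τ) * τ * s K⁻¹ * Q := by
          rw [inv_outerTwist_mul_flip]; simp only [interchange s]
      _ = ε * s (μ * K⁻¹) * Q := by
          rw [shift_counit_mul_flip, mul_assoc μ, shift_counit_mul_flip]
          simp only [interchange s]
      _ = ε * s m * Q := by rw [← mul_eq_mulZero_mul_inv_twist]
  have shift_mul_mul : s m * P = s m * Q :=
    calc s m * P = s ε * φ * s m * P := by rw [H.shift_counit_comul, one_mul]
      _ = s ε * s (s m) * (φ * P) := by simp only [interchange s]
      _ = s (ε * s m * P) * φ := by
          rw [H.semiconjBy_comul_outerTwist.eq]; simp only [map_mul, mul_assoc]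
      _ = s ε * s (s m) * (φ * Q) := by
          rw [counit_mul_mul, H.semiconjBy_comul_outerTwist'.eq]; simp only [map_mul, mul_assoc]
      _ = s ε * φ * s m * Q := by simp only [interchange s]
      _ = s m * Q := by rw [H.shift_counit_comul, one_mul]
  have shift_galois_mul : s (m * s φ) * P = s (m * s φ) * Q :=
    calc s (m * s φ) * P = s m * P * s (s φ) := by
          rw [map_mul, mul_assoc, H.commute_shift_shift_comul_outerTwist.eq, mul_assoc]
      _ = s (m * s φ) * Q := by
          rw [shift_mul_mul, mul_assoc, ← H.commute_shift_shift_comul_outerTwist'.eq, map_mul,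
            mul_assoc]
  ext
  calc P = s (m * s κ * s φ * (m * s φ)) * P := by rw [galois_left_inv, map_one, one_mul]
    _ = s (m * s κ * s φ) * (s (m * s φ) * P) := by rw [map_mul, mul_assoc]
    _ = Q := by rw [shift_galois_mul, ← mul_assoc, ← map_mul, galois_left_inv, map_one, one_mul]

theorem commute_outerTwist_twist : Commute P K := by
  rw [outerTwist_eq_outerTwist']
  exact H.commute_outerTwist'_twist

theorem flip_mul_shift_mulZero : τ * s μ = μ * s τ * τ :=
  calc τ * s μ = τ * s μ * s K⁻¹ * P * P⁻¹ * s K := by simp only [interchange s]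
    _ = μ * s τ * (P⁻¹ * τ) * s K := by
        rw [flip_mul_shift_mulZero_twisted, ← outerTwist_eq_outerTwist']
        simp only [interchange s]
    _ = μ * s τ * τ := by rw [inv_outerTwist_mul_flip]; simp only [interchange s]

theorem flip_mul_mulZero_twisted : τ * μ * K⁻¹ = s μ * τ * P⁻¹ * s τ := by
  rw [← Units.mul_left_inj H.outerTwist, ← Units.mul_left_inj (Units.map s H.twist)]
  calc τ * μ * K⁻¹ * P * s K = τ * (μ * (P * s K)) * K⁻¹ := by
        rw [mul_assoc _ K⁻¹, ← H.commute_outerTwist_twist.units_inv_right.eq]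
        simp only [mul_assoc]
        rw [H.commute_twist_shift_twist.units_inv_left.eq]
    _ = σ * m := by
        rw [outerTwist_eq_outerTwist', ← twist_mul_mulZero, mul_eq_mulZero_mul_inv_twist,
          braiding_eq_flip_mul_twist]
        simp only [Units.val_mul, mul_assoc]
    _ = s μ * s K⁻¹ * σ * s σ := by
        rw [H.braiding_mul, ← map_mul, ← mul_eq_mulZero_mul_inv_twist]
    _ = s μ * τ * P⁻¹ * s τ * P * s K := by
        rw [mul_assoc _ (s τ), val_outerTwist, outerTwist_eq_outerTwist', val_inv_outerTwist',
          braiding_eq_flip_mul_twist]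
        simp only [Units.val_mul, interchange s]

theorem shift_coform_mul_flip_mul_shift_flip : s β * τ * s τ = β :=
  calc s β * τ * s τ = s ε * (s μ * τ * P⁻¹ * s τ) := by
        rw [← counit_mul_counit_mul_inv_twist, ← counit_mul_mulZero, outerTwist_eq_outerTwist',
          val_inv_outerTwist']
        simp only [interchange s]
    _ = (s ε * τ) * (μ * K⁻¹) := by rw [← flip_mul_mulZero_twisted]; simp only [mul_assoc]
    _ = β := by rw [shift_counit_mul_flip, ← mul_eq_mulZero_mul_inv_twist, coform]

theorem shift_inv_twist_mul_flip_mul_shift_flip : s K⁻¹ * τ * s τ = τ * s τ * K⁻¹ :=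
  calc s K⁻¹ * τ * s τ = s (s β) * s (s (s φ)) * (s φ * τ) * s τ := by
        rw [val_inv_twist, twistBy_eq]; simp only [map_mul, mul_assoc]
    _ = τ * s (s β) * s τ * s (s (s φ)) * s (s τ) * φ := by
        rw [shift_comul_mul_flip]
        simp only [interchange s]
    _ = τ * s (s β * τ * s τ) * s (s (s τ)) * s (s φ) * φ := by
        rw [mul_assoc _ (s (s (s φ))), ← map_mul, ← map_mul, shift_comul_mul_flip]
        simp only [interchange s]
    _ = τ * s τ * K⁻¹ := by
        rw [shift_coform_mul_flip_mul_shift_flip, val_inv_twist, twistBy_eq]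
        simp only [interchange s]

theorem inv_outerTwist_mul_shift_flip : P⁻¹ * s τ = s τ * K⁻¹ :=
  calc P⁻¹ * s τ = τ⁻¹ * (s K⁻¹ * τ * s τ) := by
        rw [outerTwist_eq_outerTwist', val_inv_outerTwist']; simp only [mul_assoc]
    _ = s τ * K⁻¹ := by rw [shift_inv_twist_mul_flip_mul_shift_flip]; simp only [interchange s]

theorem flip_mul_mulZero : τ * μ = s μ * τ * s τ :=
  calc τ * μ = τ * μ * K⁻¹ * K := by simp only [interchange s]
    _ = s μ * τ * (P⁻¹ * s τ) * K := by rw [flip_mul_mulZero_twisted]; simp only [mul_assoc]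
    _ = s μ * τ * s τ := by rw [inv_outerTwist_mul_shift_flip]; simp only [interchange s]

local notation "K[" n "]" => Units.val (twist H ^ n)
local notation "P[" n "]" => Units.val (outerTwist H ^ n)

theorem semiconjBy_comul_twist_outerTwist : SemiconjBy φ K P := by
  refine H.semiconjBy_comul_twist.eq.trans ?_
  calc s K * φ = s τ⁻¹ * (s σ * φ) := by
        rw [braiding_eq_flip_mul_twist]; simp only [Units.val_mul, interchange s]
    _ = P * φ := by rw [← twist_mul_shift_flip_mul_comul, val_outerTwist]; simp only [mul_assoc]

theorem semiconjBy_shift_comul_twist_outerTwist : SemiconjBy (s φ) K P := by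
  refine H.commute_shift_comul_twist.eq.trans ?_
  calc K * s φ = τ⁻¹ * (σ * s φ) := by
        rw [braiding_eq_flip_mul_twist]; simp only [Units.val_mul, interchange s]
    _ = P * s φ := by
        rw [← shift_twist_mul_flip_mul_shift_comul, outerTwist_eq_outerTwist', val_outerTwist']
        simp only [mul_assoc]

theorem comul_mul_zpow_twist_mul_comul (n : ℤ) :
    φ * (K[n] * φ) = s φ * (K[n] * φ) := by
  rw [← mul_assoc, (H.semiconjBy_comul_twist_outerTwist.units_zpow_right n).eq, mul_assoc,
    H.comul_comul, ← mul_assoc, ← (H.semiconjBy_shift_comul_twist_outerTwist.units_zpow_right n).eq,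
    mul_assoc]

theorem comul_mul_counit_zpow_twist_comul (n : ℤ) : φ * (ε * K[n] * φ) = K[n] * φ :=
  calc φ * (ε * K[n] * φ) = ε * (s φ * (K[n] * φ)) := by simp only [interchange s]
    _ = ε * φ * (K[n] * φ) := by rw [← comul_mul_zpow_twist_mul_comul, mul_assoc]
    _ = K[n] * φ := by rw [H.counit_comul, one_mul]

theorem counit_zpow_twist_comul_eq (n : ℤ) : ε * K[n] * φ = s ε * K[n] * φ :=
  calc ε * K[n] * φ = s ε * φ * (ε * K[n] * φ) := by rw [H.shift_counit_comul, one_mul]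
    _ = s ε * K[n] * φ := by rw [mul_assoc, comul_mul_counit_zpow_twist_comul, mul_assoc]

theorem shift_counit_zpow_twist_comul_mul_comul (n : ℤ) :
    s (ε * K[n] * φ) * φ = K[n] * φ :=
  calc s (ε * K[n] * φ) * φ = s ε * (s K[n] * φ) * φ := by
        simp only [map_mul, mul_assoc, H.comul_comul]
    _ = s ε * φ * (K[n] * φ) := by
        rw [← (semiconjBy_map_units_zpow H.semiconjBy_comul_twist n).eq]; simp only [mul_assoc]
    _ = K[n] * φ := by rw [H.shift_counit_comul, one_mul]

theorem counit_zpow_twist_comul_mul_comul (n : ℤ) : ε * K[n] * φ * φ = K[n] * φ :=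
  calc ε * K[n] * φ * φ = s ε * (K[n] * s φ) * φ := by
        rw [counit_zpow_twist_comul_eq, mul_assoc, H.comul_comul]; simp only [mul_assoc]
    _ = s (ε * φ) * (K[n] * φ) := by
        rw [← (H.commute_shift_comul_twist.units_zpow_right n).eq]; simp only [map_mul, mul_assoc]
    _ = K[n] * φ := by rw [H.counit_comul, map_one, one_mul]

theorem counit_zpow_twist_comul_mul_neg (n : ℤ) :
    ε * K[n] * φ * (ε * K[-n] * φ) = 1 := by
  rw [mul_assoc, comul_mul_counit_zpow_twist_comul, zpow_neg]
  simp only [interchange s, H.counit_comul]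

theorem twist_mul_unit : K * η = η := by
  have form_mul_unit : α * η = ε := by
    rw [form, mul_assoc, H.braiding_unit]
    simpa only [interchange s] using congrArg (· * ε) H.counit_unit
  calc K * η = s α * (φ * η) * φ := by rw [val_twist, twistBy]; simp only [interchange s]
    _ = η * (α * η) * φ := by rw [H.comul_unit]; simp only [interchange s]
    _ = η := by rw [form_mul_unit, mul_assoc, H.counit_comul, mul_one]

theorem twist_mul_shift_unit : K * s η = s η := by
  have form_mul_shift_unit : α * s η = ε := by
    rw [form, mul_assoc, H.braiding_shift_unit, mul_assoc, H.counit_unit, mul_one]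
  calc K * s η = s α * s (s (φ * η)) * φ := by
        rw [val_twist, twistBy_eq]; simp only [interchange s]
    _ = s η * (s (α * s η) * φ) := by rw [H.comul_unit]; simp only [interchange s]
    _ = s η := by rw [form_mul_shift_unit, H.shift_counit_comul, mul_one]

theorem shift_comul_mul_inv_flip : s φ * τ⁻¹ = τ⁻¹ * s τ⁻¹ * φ :=
  calc s φ * τ⁻¹ = τ⁻¹ * s τ⁻¹ * (s τ * τ * s φ) * τ⁻¹ := by simp only [interchange s]
    _ = τ⁻¹ * s τ⁻¹ * φ := by rw [← comul_mul_flip]; simp only [interchange s]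

theorem comul_mul_inv_flip : φ * τ⁻¹ = s τ⁻¹ * τ⁻¹ * s φ :=
  calc φ * τ⁻¹ = s τ⁻¹ * τ⁻¹ * (τ * s τ * φ) * τ⁻¹ := by simp only [interchange s]
    _ = s τ⁻¹ * τ⁻¹ * s φ := by rw [← shift_comul_mul_flip]; simp only [interchange s]

/-! ### The antipode -/

-- Convolving an operator on two strands with the identity on its second strand loses no
-- information, since the antipode is a convolution inverse of the identity.
theorem antipode_convolution_shift (x : M) [Local s 2 2 x] :
    s m * s κ * τ⁻¹ * s (s m * (τ⁻¹ * s x * τ) * s φ) * τ * s φ = x := by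
  have antipode_mul : s m * s κ * s (s m) * s φ = s ε :=
    calc s m * s κ * s (s m) * s φ = s (m * s m) * s κ * s φ := by simp only [interchange s]
      _ = s (m * (m * κ * φ)) := by rw [← H.mul_mul]; simp only [map_mul, mul_assoc]
      _ = s ε := by rw [H.mul_antipode_comul, ← mul_assoc, H.mul_unit, one_mul]
  calc s m * s κ * τ⁻¹ * s (s m * (τ⁻¹ * s x * τ) * s φ) * τ * s φ
      = s m * s κ * s (s m) * (τ⁻¹ * s τ⁻¹ * s (s x) * s τ * τ) * s (s φ * φ) := by
        simp only [interchange s]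
    _ = s m * s κ * s (s m) * τ⁻¹ * s τ⁻¹ * s (s x) * (s τ * τ * s φ) * s φ := by
        rw [← H.comul_comul]; simp only [map_mul, mul_assoc]
    _ = s m * s κ * s (s m) * (τ⁻¹ * s τ⁻¹ * φ) * s x * τ * s φ := by
        rw [← comul_mul_flip]; simp only [interchange s]
    _ = s ε * τ⁻¹ * s x * τ * s φ := by
        rw [← shift_comul_mul_inv_flip, ← antipode_mul]; simp only [mul_assoc]
    _ = x * (ε * τ) * s φ := by rw [shift_counit_mul_inv_flip]; simp only [interchange s]
    _ = x := by
        rw [counit_mul_flip, mul_assoc, ← map_mul, H.counit_comul, map_one, mul_one]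

theorem antipode_convolution (x : M) [Local s 2 2 x] :
    m * s κ * s τ⁻¹ * (m * (s τ⁻¹ * x * s τ) * φ) * s τ * φ = x := by
  have antipode_mul : m * s κ * m * s φ = s ε :=
    calc m * s κ * m * s φ = m * m * s (s κ) * s φ := by simp only [interchange s]
      _ = m * s (m * s κ * φ) := by rw [H.mul_mul]; simp only [map_mul, mul_assoc]
      _ = s ε := by
          rw [H.mul_shift_antipode_comul, map_mul, ← mul_assoc, H.mul_shift_unit, one_mul]
  calc m * s κ * s τ⁻¹ * (m * (s τ⁻¹ * x * s τ) * φ) * s τ * φ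
      = m * s κ * m * s (s τ⁻¹) * s τ⁻¹ * x * s τ * s (s τ) * (φ * φ) := by
        simp only [interchange s]
    _ = m * s κ * m * s (s τ⁻¹) * s τ⁻¹ * x * s (τ * s τ * φ) * φ := by
        rw [H.comul_comul]; simp only [map_mul, mul_assoc]
    _ = m * s κ * m * s (s τ⁻¹ * τ⁻¹ * s φ) * x * s τ * φ := by
        rw [← shift_comul_mul_flip]; simp only [interchange s]
    _ = s (ε * τ⁻¹) * x * s τ * φ := by
        rw [← comul_mul_inv_flip, map_mul s ε, ← antipode_mul]; simp only [map_mul, mul_assoc]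
    _ = x * s (s ε * τ) * φ := by rw [counit_mul_inv_flip]; simp only [interchange s]
    _ = x := by rw [shift_counit_mul_flip, mul_assoc, H.shift_counit_comul, mul_one]

theorem twist_mul_mul : K * m = m * (P * s K) := by
  have commute_twist : Commute K⁻¹ (P * s K) :=
    (H.commute_outerTwist_twist.symm.mul_right H.commute_twist_shift_twist).units_inv_left
  rw [mul_eq_mulZero_mul_inv_twist, ← mul_assoc, twist_mul_mulZero, ← outerTwist_eq_outerTwist',
    mul_assoc μ, mul_assoc μ, commute_twist.eq]

theorem twist_mul_shift_mul : K * s m = s m * (P * K) := by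
  have commute_twist : Commute (s K⁻¹) (P * K) :=
    ((commute_map_units_inv H.commute_outerTwist_shift_twist).mul_left
      (commute_map_units_inv H.commute_twist_shift_twist)).symm
  rw [mul_eq_mulZero_mul_inv_twist, map_mul, ← mul_assoc, twist_mul_shift_mulZero, mul_assoc (s μ),
    mul_assoc (s μ), commute_twist.eq]

theorem twist_mul_shift_antipode : K * s κ = s κ * K⁻¹ := by
  have convolution_eq :
      s m * (τ⁻¹ * s (K * s κ * K) * τ) * s φ = s m * (τ⁻¹ * s (s κ) * τ) * s φ :=
    calc s m * (τ⁻¹ * s (K * s κ * K) * τ) * s φ = s m * P * s (s κ) * (P * s φ) := by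
          rw [outerTwist_eq_outerTwist', val_outerTwist']; simp only [interchange s]
      _ = s m * (P * K) * K⁻¹ * s (s κ) * s φ * K := by
          rw [← H.semiconjBy_shift_comul_twist_outerTwist.eq]; simp only [interchange s]
      _ = K * s (m * s κ * φ) := by
          rw [← twist_mul_shift_mul, mul_assoc _ (s φ), H.commute_shift_comul_twist.eq]
          simp only [interchange s]
      _ = s (m * s κ * φ) := by
          rw [H.mul_shift_antipode_comul, map_mul, ← mul_assoc, twist_mul_shift_unit]
      _ = s m * (τ⁻¹ * s (s κ) * τ) * s φ := by simp only [interchange s]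
  have local_conj : Local s 2 2 (K * s κ * K) := ⟨fun y => by simp only [interchange s]⟩
  have antipode_eq : K * s κ * K = s κ := by
    rw [← H.antipode_convolution_shift (K * s κ * K), convolution_eq, antipode_convolution_shift]
  rw [← Units.mul_left_inj H.twist, antipode_eq, mul_assoc, Units.inv_mul, mul_one]

theorem twist_mul_antipode : K * κ = κ * K⁻¹ := by
  have convolution_eq :
      m * (s τ⁻¹ * (K * κ * K) * s τ) * φ = m * (s τ⁻¹ * κ * s τ) * φ :=
    calc m * (s τ⁻¹ * (K * κ * K) * s τ) * φ = m * P * κ * (P * φ) := by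
          rw [val_outerTwist]; simp only [interchange s]
      _ = m * (P * s K) * κ * s K⁻¹ * (φ * K) := by
          rw [← H.semiconjBy_comul_twist_outerTwist.eq]; simp only [interchange s]
      _ = K * (m * κ * φ) := by
          rw [← twist_mul_mul, H.semiconjBy_comul_twist.eq]; simp only [interchange s]
      _ = m * κ * φ := by rw [H.mul_antipode_comul, ← mul_assoc, twist_mul_unit]
      _ = m * (s τ⁻¹ * κ * s τ) * φ := by simp only [interchange s]
  have local_conj : Local s 2 2 (K * κ * K) := ⟨fun y => by simp only [interchange s]⟩
  have local_antipode : Local s 2 2 κ := ⟨fun y => by simp only [interchange s]⟩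
  have antipode_eq : K * κ * K = κ := by
    rw [← H.antipode_convolution (K * κ * K), convolution_eq, antipode_convolution]
  rw [← Units.mul_left_inj H.twist, antipode_eq, mul_assoc, Units.inv_mul, mul_one]

theorem zpow_twist_mul_shift_antipode (n : ℤ) : K[n] * s κ = s κ * K[-n] := by
  have semiconj : SemiconjBy (s κ) (H.twist⁻¹ : Mˣ) K := H.twist_mul_shift_antipode.symm
  rw [zpow_neg, ← inv_zpow, (semiconj.units_zpow_right n).eq]

theorem zpow_twist_mul_antipode (n : ℤ) : K[n] * κ = κ * K[-n] := by
  have semiconj : SemiconjBy κ (H.twist⁻¹ : Mˣ) K := H.twist_mul_antipode.symm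
  rw [zpow_neg, ← inv_zpow, (semiconj.units_zpow_right n).eq]

theorem zpow_twist_mul_mulZero (n : ℤ) : K[n] * μ = μ * (P[n] * s K[n]) := by
  have semiconj : SemiconjBy μ (H.outerTwist * Units.map s H.twist : Mˣ) K := by
    rw [outerTwist_eq_outerTwist']; exact H.twist_mul_mulZero.symm
  have commute_twists : Commute H.outerTwist (Units.map (s : M →* M) H.twist) :=
    Units.ext H.commute_outerTwist_shift_twist
  have := (semiconj.units_zpow_right n).eq
  rw [commute_twists.mul_zpow, ← map_zpow] at this
  exact this.symm

theorem zpow_twist_mul_shift_mulZero (n : ℤ) : K[n] * s μ = s μ * (P[n] * K[n]) := by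
  have semiconj : SemiconjBy (s μ) (H.outerTwist * H.twist : Mˣ) K :=
    H.twist_mul_shift_mulZero.symm
  have commute_twists : Commute H.outerTwist H.twist := Units.ext H.commute_outerTwist_twist
  have := (semiconj.units_zpow_right n).eq
  rw [commute_twists.mul_zpow] at this
  exact this.symm

theorem zpow_twist_mul_shift_flip (n : ℤ) : K[n] * s τ = s τ * P[n] := by
  have semiconj : SemiconjBy (s τ) P K := by
    rw [SemiconjBy, val_outerTwist]; simp only [interchange s]
  exact (semiconj.units_zpow_right n).eq.symm

theorem zpow_outerTwist_mul_shift_flip (n : ℤ) : P[n] * s τ = s τ * K[n] := by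
  have semiconj : SemiconjBy (s τ) K P :=
    (SemiconjBy.units_inv_right_iff (x := H.twist) (y := H.outerTwist)).1
      H.inv_outerTwist_mul_shift_flip.symm
  exact (semiconj.units_zpow_right n).eq.symm

theorem shift_zpow_twist_mul_flip (n : ℤ) : s K[n] * τ = τ * P[n] := by
  have semiconj : SemiconjBy τ P (s K) := by
    rw [SemiconjBy, outerTwist_eq_outerTwist', val_outerTwist']; simp only [interchange s]
  exact (semiconjBy_map_units_zpow semiconj n).eq.symm

theorem zpow_outerTwist_mul_flip (n : ℤ) : P[n] * τ = τ * s K[n] := by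
  have semiconj : SemiconjBy τ (Units.map (s : M →* M) H.twist) P :=
    (SemiconjBy.units_inv_right_iff (y := H.outerTwist)).1 H.inv_outerTwist_mul_flip.symm
  have := (semiconj.units_zpow_right n).eq
  rw [← map_zpow] at this
  exact this.symm

theorem commute_zpow_outerTwist_zpow_twist (n p : ℤ) : Commute P[n] K[p] :=
  (H.commute_outerTwist_twist.units_zpow_left n).units_zpow_right p

theorem commute_zpow_outerTwist_shift_zpow_twist (n p : ℤ) : Commute P[n] (s K[p]) :=
  commute_map_units_zpow (H.commute_outerTwist_shift_twist.units_zpow_left n) p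

theorem commute_zpow_twist_shift_zpow_twist (n p : ℤ) : Commute K[n] (s K[p]) :=
  commute_map_units_zpow (H.commute_twist_shift_twist.units_zpow_left n) p

theorem mulZero_zpow_twist_mul_mulZero_zpow_twist (n : ℤ) :
    μ * K[n] * (μ * K[n]) = μ * μ * (P[n] * (s K[n] * K[n])) := by
  rw [mul_assoc, ← mul_assoc K[n], zpow_twist_mul_mulZero]; simp only [mul_assoc]

theorem mulZero_zpow_twist_mul_shift_mulZero_zpow_twist (n : ℤ) :
    μ * K[n] * s (μ * K[n]) = μ * s μ * (P[n] * (s K[n] * K[n])) := by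
  rw [map_mul, mul_assoc, ← mul_assoc K[n], zpow_twist_mul_shift_mulZero,
    (H.commute_zpow_twist_shift_zpow_twist n n).symm.eq]
  simp only [mul_assoc, (H.commute_zpow_twist_shift_zpow_twist n n).eq]

theorem mulZero_mul_mulZero : μ * μ = μ * s μ := by
  have mul_eq : m = μ * K[(-1 : ℤ)] := by rw [zpow_neg_one, mul_eq_mulZero_mul_inv_twist]
  rw [← Units.mul_left_inj (H.outerTwist ^ (-1 : ℤ) *
    (Units.map s (H.twist ^ (-1 : ℤ)) * H.twist ^ (-1 : ℤ)))]
  simp only [Units.val_mul, Units.coe_map]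
  rw [← mulZero_zpow_twist_mul_mulZero_zpow_twist,
    ← mulZero_zpow_twist_mul_shift_mulZero_zpow_twist, ← mul_eq, H.mul_mul]

/-! ### The deformations -/

/-- The braiding `σₙ = (σ τ⁻¹)ⁿ⁻¹ σ`. -/
def braidingPow (n : ℤ) : Mˣ := (H.braiding * H.flip⁻¹) ^ (n - 1) * H.braiding

local notation "σ[" n "]" => Units.val (braidingPow H n)
local notation "σ⁻¹[" n "]" => Units.val (braidingPow H n)⁻¹

theorem braidingPow_eq (n : ℤ) : H.braidingPow n = H.flip * H.twist ^ n := by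
  have conj_eq : H.braiding * H.flip⁻¹ = H.flip * H.twist * H.flip⁻¹ := by
    rw [braiding_eq_flip_mul_twist]
  rw [braidingPow, conj_eq, conj_zpow, zpow_sub_one, braiding_eq_flip_mul_twist]
  group

theorem val_braidingPow (n : ℤ) : σ[n] = τ * K[n] := by rw [braidingPow_eq, Units.val_mul]

theorem val_inv_braidingPow (n : ℤ) : σ⁻¹[n] = K[-n] * τ⁻¹ := by
  rw [braidingPow_eq, mul_inv_rev, zpow_neg, Units.val_mul]

theorem inv_braidingPow_mul_braiding (n : ℤ) :
    (H.braidingPow n)⁻¹ * H.braiding = H.twist ^ (1 - n) := by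
  rw [braidingPow_eq, braiding_eq_flip_mul_twist]
  group

/-- The product `mₙ = m σₙ⁻¹ σ`. -/
def mulPow (n : ℤ) : M := m * (σ⁻¹[n] * σ)

local notation "m[" n "]" => mulPow H n

theorem mulPow_eq (n : ℤ) : m[n] = μ * K[-n] := by
  rw [mulPow, ← Units.val_mul, inv_braidingPow_mul_braiding, sub_eq_add_neg, zpow_one_add,
    Units.val_mul, ← mul_assoc, mulZero]

/-- The operator `(ε ⊗ id) σₙ⁻¹ σ φ`, whose composition with the antipode `κ` is `κₙ`. -/
def counitTwist (n : ℤ) : M := ε * (σ⁻¹[n] * σ) * φ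

theorem counitTwist_eq (n : ℤ) : H.counitTwist n = ε * K[1 - n] * φ := by
  rw [counitTwist, ← Units.val_mul, inv_braidingPow_mul_braiding]

instance local_braidingPow (n : ℤ) : Local s 2 2 σ[n] :=
  ⟨fun y => by rw [val_braidingPow]; simp only [interchange s]⟩

instance local_mulPow (n : ℤ) : Local s 2 1 m[n] := ⟨fun y => by simp only [mulPow, interchange s]⟩

instance local_counitTwist (n : ℤ) : Local s 1 1 (H.counitTwist n) :=
  ⟨fun y => by simp only [counitTwist, interchange s]⟩

theorem mulPow_mul_mulPow (n : ℤ) : m[n] * m[n] = m[n] * s m[n] := by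
  rw [mulPow_eq, mulZero_zpow_twist_mul_mulZero_zpow_twist, mulZero_mul_mulZero,
    mulZero_zpow_twist_mul_shift_mulZero_zpow_twist]

theorem zpow_twist_mul_unit (n : ℤ) : K[n] * η = η := by
  have semiconj : SemiconjBy η (1 : Mˣ) K := by
    rw [SemiconjBy, twist_mul_unit, Units.val_one, mul_one]
  simpa only [one_zpow, Units.val_one, mul_one] using (semiconj.units_zpow_right n).eq.symm

theorem zpow_twist_mul_shift_unit (n : ℤ) : K[n] * s η = s η := by
  have semiconj : SemiconjBy (s η) (1 : Mˣ) K := by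
    rw [SemiconjBy, twist_mul_shift_unit, Units.val_one, mul_one]
  simpa only [one_zpow, Units.val_one, mul_one] using (semiconj.units_zpow_right n).eq.symm

theorem mulPow_mul_unit (n : ℤ) : m[n] * η = 1 := by
  rw [mulPow_eq, mul_assoc, zpow_twist_mul_unit, mulZero, mul_assoc, twist_mul_unit, H.mul_unit]

theorem mulPow_mul_shift_unit (n : ℤ) : m[n] * s η = 1 := by
  rw [mulPow_eq, mul_assoc, zpow_twist_mul_shift_unit, mulZero, mul_assoc, twist_mul_shift_unit,
    H.mul_shift_unit]

theorem braidingPow_mul_mulPow (n : ℤ) : σ[n] * m[n] = s m[n] * σ[n] * s σ[n] := by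
  rw [mulPow_eq, val_braidingPow, map_mul, map_mul]
  calc τ * K[n] * (μ * K[-n]) = τ * μ * P[n] * s K[n] * K[-n] := by
        rw [mul_assoc, ← mul_assoc K[n], zpow_twist_mul_mulZero]; simp only [mul_assoc]
    _ = s μ * τ * (s τ * K[-n]) * P[n] * s K[n] := by
        rw [flip_mul_mulZero, mul_assoc _ (s K[n]),
          ← (H.commute_zpow_twist_shift_zpow_twist (-n) n).eq, ← mul_assoc, mul_assoc _ P[n],
          (H.commute_zpow_outerTwist_zpow_twist n (-n)).eq]
        simp only [mul_assoc]
    _ = s μ * (τ * P[-n]) * (s τ * P[n]) * s K[n] := by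
        rw [← zpow_outerTwist_mul_shift_flip]; simp only [mul_assoc]
    _ = s μ * s K[-n] * (τ * K[n]) * (s τ * s K[n]) := by
        rw [← shift_zpow_twist_mul_flip, ← zpow_twist_mul_shift_flip]; simp only [mul_assoc]

theorem braidingPow_mul_shift_mulPow (n : ℤ) : σ[n] * s m[n] = m[n] * s σ[n] * σ[n] := by
  rw [mulPow_eq, val_braidingPow, map_mul, map_mul]
  calc τ * K[n] * (s μ * s K[-n]) = τ * s μ * P[n] * (K[n] * s K[-n]) := by
        rw [mul_assoc, ← mul_assoc K[n], zpow_twist_mul_shift_mulZero]; simp only [mul_assoc]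
    _ = μ * s τ * (τ * s K[-n]) * P[n] * K[n] := by
        rw [flip_mul_shift_mulZero, (H.commute_zpow_twist_shift_zpow_twist n (-n)).eq,
          mul_assoc _ P[n], ← mul_assoc P[n],
          (H.commute_zpow_outerTwist_shift_zpow_twist n (-n)).eq]
        simp only [mul_assoc]
    _ = μ * (s τ * P[-n]) * (τ * P[n]) * K[n] := by
        rw [← zpow_outerTwist_mul_flip]; simp only [mul_assoc]
    _ = μ * K[-n] * (s τ * s K[n]) * (τ * K[n]) := by
        rw [← zpow_twist_mul_shift_flip, ← shift_zpow_twist_mul_flip]; simp only [mul_assoc]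

theorem commute_zpow_twist_flip_comul_comul (n : ℤ) : Commute K[n] (s τ * φ * s φ) :=
  calc K[n] * (s τ * φ * s φ) = s τ * (P[n] * φ) * s φ := by
        simp only [← mul_assoc, zpow_twist_mul_shift_flip]
    _ = s τ * φ * (K[n] * s φ) := by
        rw [← (H.semiconjBy_comul_twist_outerTwist.units_zpow_right n).eq]; simp only [mul_assoc]
    _ = s τ * φ * s φ * K[n] := by
        rw [← (H.commute_shift_comul_twist.units_zpow_right n).eq]; simp only [mul_assoc]

theorem shift_shift_zpow_twist_mul_flip_comul_comul (n : ℤ) :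
    s (s K[n]) * (s τ * φ * s φ) = s τ * φ * s φ * K[n] :=
  calc s (s K[n]) * (s τ * φ * s φ) = s τ * (s P[n] * φ) * s φ := by
        simp only [← mul_assoc, ← map_mul, shift_zpow_twist_mul_flip]
    _ = s τ * φ * (P[n] * s φ) := by
        rw [← (semiconjBy_map_units_zpow H.semiconjBy_comul_outerTwist n).eq]
        simp only [mul_assoc]
    _ = s τ * φ * s φ * K[n] := by
        rw [← (H.semiconjBy_shift_comul_twist_outerTwist.units_zpow_right n).eq]
        simp only [mul_assoc]

theorem comul_mul_mulPow (n : ℤ) :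
    φ * m[n] = m[n] * s (s m[n]) * s σ[n] * φ * s φ := by
  rw [mulPow_eq, val_braidingPow]
  calc φ * (μ * K[-n]) = μ * s (s μ) * (s τ * φ * s φ * K[-n]) := by
        rw [← mul_assoc, comul_mul_mulZero]; simp only [mul_assoc]
    _ = μ * s (s μ) * (K[-n] * (s (s K[-n]) * (s τ * φ * s φ * K[n]))) := by
        rw [← mul_assoc (s (s K[-n])), shift_shift_zpow_twist_mul_flip_comul_comul, zpow_neg,
          mul_assoc _ _ K[n], Units.inv_mul, mul_one, ← zpow_neg,
          (H.commute_zpow_twist_flip_comul_comul (-n)).eq]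
    _ = μ * K[-n] * s (s (μ * K[-n])) * s τ * φ * s φ * K[n] := by
        simp only [interchange s]
    _ = μ * K[-n] * s (s (μ * K[-n])) * s (τ * K[n]) * φ * s φ := by
        rw [mul_assoc _ (s φ), (H.commute_shift_comul_twist.units_zpow_right n).eq, ← mul_assoc,
          mul_assoc _ φ, (semiconjBy_map_units_zpow H.semiconjBy_comul_twist n).eq]
        simp only [map_mul, mul_assoc]

theorem braidingPow_mul_shift_comul_mul_inv (n : ℤ) :
    σ[n] * s φ * σ⁻¹[n] = τ * s φ * τ⁻¹ := by
  rw [val_braidingPow, val_inv_braidingPow, mul_assoc τ,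
    ← (H.commute_shift_comul_twist.units_zpow_right n).eq, zpow_neg]
  simp only [interchange s]

theorem shift_braidingPow_mul_comul_mul_inv (n : ℤ) :
    s σ[n] * φ * σ⁻¹[n] = s τ * φ * τ⁻¹ := by
  rw [val_braidingPow, val_inv_braidingPow, map_mul, mul_assoc (s τ),
    ← (semiconjBy_map_units_zpow H.semiconjBy_comul_twist n).eq, zpow_neg]
  simp only [interchange s]

theorem flip_comul : τ * s φ * τ⁻¹ * s φ = s (s τ * φ * τ⁻¹) * φ := by
  have braidingPow_one : H.braidingPow 1 = H.braiding := by
    rw [braidingPow, sub_self, zpow_zero, one_mul]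
  rw [← H.braidingPow_mul_shift_comul_mul_inv 1, ← H.shift_braidingPow_mul_comul_mul_inv 1,
    braidingPow_one, H.braiding_comul, map_mul, map_mul]

theorem braidingPow_comul (n : ℤ) :
    σ[n] * s φ * σ⁻¹[n] * s φ = s (s σ[n]) * s φ * s σ⁻¹[n] * φ := by
  rw [braidingPow_mul_shift_comul_mul_inv, flip_comul, ← H.shift_braidingPow_mul_comul_mul_inv n,
    map_mul, map_mul]

theorem isUnit_counitTwist (n : ℤ) : IsUnit (H.counitTwist n) := by
  rw [counitTwist_eq, isUnit_iff_exists]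
  refine ⟨_, H.counit_zpow_twist_comul_mul_neg (1 - n), ?_⟩
  simpa only [neg_neg] using H.counit_zpow_twist_comul_mul_neg (-(1 - n))

theorem mulPow_mul_zpow_twist (n : ℤ) : m[n] * K[n - 1] = m := by
  rw [mulPow_eq, mul_assoc, ← Units.val_mul, ← zpow_add,
    show -n + (n - 1) = -1 by ring, zpow_neg_one, ← mul_eq_mulZero_mul_inv_twist]

theorem mulPow_mul_shift_antipode_counitTwist_comul (n : ℤ) :
    m[n] * s (κ * H.counitTwist n) * φ = η * ε :=
  calc m[n] * s (κ * H.counitTwist n) * φ = m[n] * (s κ * K[-(n - 1)]) * φ := by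
        rw [map_mul, ← mul_assoc, mul_assoc, counitTwist_eq, neg_sub,
          shift_counit_zpow_twist_comul_mul_comul]
        simp only [mul_assoc]
    _ = η * ε := by
        rw [← zpow_twist_mul_shift_antipode, ← mul_assoc, mulPow_mul_zpow_twist,
          H.mul_shift_antipode_comul]

theorem mulPow_mul_antipode_counitTwist_comul (n : ℤ) :
    m[n] * (κ * H.counitTwist n) * φ = η * ε :=
  calc m[n] * (κ * H.counitTwist n) * φ = m[n] * (κ * K[-(n - 1)]) * φ := by
        rw [← mul_assoc, mul_assoc, counitTwist_eq, neg_sub, counit_zpow_twist_comul_mul_comul]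
        simp only [mul_assoc]
    _ = η * ε := by
        rw [← zpow_twist_mul_antipode, ← mul_assoc, mulPow_mul_zpow_twist, H.mul_antipode_comul]

/-- The braided quantum group `Gₙ`. -/
def deform (n : ℤ) : StrandGroup s where
  mul := m[n]
  unit := η
  comul := φ
  counit := ε
  antipode := κ * H.counitTwist n
  braiding := H.braidingPow n
  local_mul := inferInstance
  local_unit := inferInstance
  local_comul := inferInstance
  local_counit := inferInstance
  local_antipode := ⟨fun y => by simp only [interchange s]⟩
  local_braiding := inferInstance
  mul_mul := H.mulPow_mul_mulPow n
  mul_unit := H.mulPow_mul_unit n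
  mul_shift_unit := H.mulPow_mul_shift_unit n
  comul_comul := H.comul_comul
  counit_comul := H.counit_comul
  shift_counit_comul := H.shift_counit_comul
  braiding_mul := H.braidingPow_mul_mulPow n
  braiding_shift_mul := H.braidingPow_mul_shift_mulPow n
  comul_mul := H.comul_mul_mulPow n
  braiding_comul := H.braidingPow_comul n
  isUnit_antipode := H.isUnit_antipode.mul (H.isUnit_counitTwist n)
  mul_shift_antipode_comul := H.mulPow_mul_shift_antipode_counitTwist_comul n
  mul_antipode_comul := H.mulPow_mul_antipode_counitTwist_comul n

theorem counitTwist_eq_shift_counit_mul (n : ℤ) :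
    H.counitTwist n = s ε * (σ⁻¹[n] * σ) * φ := by
  rw [counitTwist_eq, counit_zpow_twist_comul_eq, ← Units.val_mul _ H.braiding,
    inv_braidingPow_mul_braiding]

theorem counit_mul_mulPow_zero : ε * m[0] = ε * ε := by
  rw [mulPow_eq, neg_zero, zpow_zero, Units.val_one, mul_one, counit_mul_mulZero]

end StrandGroup

end StrandCalculus

/-! ### Linear maps as operators on strands -/

section Reservoir

variable {R W X Y Z : Type*} [CommSemiring R] [AddCommMonoid W] [Module R W]
  [AddCommMonoid X] [Module R X] [AddCommMonoid Y] [Module R Y] [AddCommMonoid Z] [Module R Z]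

/-- A way for the module `W`, the reservoir, to absorb a tensor factor `X`. By absorbing all
factors of their source and target, maps between tensor powers become endomorphisms of `W`. -/
class Absorbed (R W X : Type*) [CommSemiring R] [AddCommMonoid W] [Module R W]
    [AddCommMonoid X] [Module R X] where
  equiv : X ⊗[R] W ≃ₗ[R] W

instance : Absorbed R W R where
  equiv := TensorProduct.lid R W

instance [Absorbed R W X] [Absorbed R W Y] : Absorbed R W (X ⊗[R] Y) where
  equiv := TensorProduct.assoc R X Y W ≪≫ₗ
    TensorProduct.congr (LinearEquiv.refl R X) Absorbed.equiv ≪≫ₗ Absorbed.equiv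

/-- The absorption of a vector `x : X`, as an operator on the reservoir. -/
def absorb [Absorbed R W X] : X →ₗ[R] Module.End R W :=
  (TensorProduct.mk R X W).compr₂ Absorbed.equiv.toLinearMap

theorem absorb_tmul [Absorbed R W X] [Absorbed R W Y] (x : X) (y : Y) :
    (absorb (x ⊗ₜ[R] y) : Module.End R W) = absorb x * absorb y := rfl

theorem absorb_scalar (c : R) : (absorb c : Module.End R W) = c • 1 :=
  LinearMap.ext fun w => TensorProduct.lid_tmul w c

theorem end_ext_absorb (X : Type*) [AddCommMonoid X] [Module R X] [Absorbed R W X]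
    {u v : Module.End R W} (h : ∀ x : X, u * absorb x = v * absorb x) : u = v := by
  have comp_equiv_eq :
      u ∘ₗ (Absorbed.equiv (X := X)).toLinearMap = v ∘ₗ Absorbed.equiv.toLinearMap :=
    TensorProduct.ext' fun x => LinearMap.congr_fun (h x)
  exact (LinearMap.cancel_right Absorbed.equiv.surjective).1 comp_equiv_eq

/-- The endomorphism of the reservoir that releases `X`, applies `f`, and absorbs `Y`. -/
def induced (W : Type*) [AddCommMonoid W] [Module R W] [Absorbed R W X] [Absorbed R W Y]
    (f : X →ₗ[R] Y) : Module.End R W :=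
  Absorbed.equiv.toLinearMap ∘ₗ f.rTensor W ∘ₗ Absorbed.equiv.symm.toLinearMap

variable [Absorbed R W X] [Absorbed R W Y] [Absorbed R W Z]

variable (R W X) in
/-- The endomorphism of the reservoir that releases `X`, applies `u` to the remainder, and absorbs
`X` again. -/
def strand : Module.End R W →* Module.End R W where
  toFun u := Absorbed.equiv.toLinearMap ∘ₗ u.lTensor X ∘ₗ Absorbed.equiv.symm.toLinearMap
  map_one' := by ext w; simp [Module.End.one_eq_id]
  map_mul' u v := by ext w; simp [LinearMap.lTensor_mul]

theorem induced_mul_absorb (f : X →ₗ[R] Y) (x : X) :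
    induced W f * absorb x = absorb (f x) := by
  ext w; simp [induced, absorb]

theorem strand_mul_absorb (u : Module.End R W) (x : X) :
    strand R W X u * absorb x = absorb x * u := by
  ext w; simp [strand, absorb]

theorem induced_mul_strand (f : X →ₗ[R] Y) (u : Module.End R W) :
    induced W f * strand R W X u = strand R W Y u * induced W f :=
  end_ext_absorb X fun x => by
    rw [mul_assoc, strand_mul_absorb, ← mul_assoc, induced_mul_absorb, mul_assoc,
      induced_mul_absorb, strand_mul_absorb]

@[simp]
theorem induced_id : induced W (LinearMap.id : X →ₗ[R] X) = 1 :=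
  end_ext_absorb X fun x => induced_mul_absorb _ x

@[simp]
theorem induced_comp (f : Y →ₗ[R] Z) (g : X →ₗ[R] Y) :
    induced W (f ∘ₗ g) = induced W f * induced W g :=
  end_ext_absorb X fun x => by
    simp only [mul_assoc, induced_mul_absorb, LinearMap.comp_apply]

@[simp]
theorem induced_lTensor (f : Y →ₗ[R] Z) :
    induced W (f.lTensor X) = strand R W X (induced W f) :=
  end_ext_absorb X fun x => end_ext_absorb Y fun y => by
    rw [strand_mul_absorb, mul_assoc, mul_assoc, ← absorb_tmul, induced_mul_absorb,
      induced_mul_absorb, LinearMap.lTensor_tmul, absorb_tmul]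

@[simp]
theorem induced_rTensor (f : Y →ₗ[R] Z) : induced W (f.rTensor X) = induced W f :=
  end_ext_absorb Y fun y => end_ext_absorb X fun x => by
    rw [induced_mul_absorb, mul_assoc, ← absorb_tmul, induced_mul_absorb,
      LinearMap.rTensor_tmul, absorb_tmul]

@[simp]
theorem induced_map {X' Y' : Type*} [AddCommMonoid X'] [Module R X'] [AddCommMonoid Y']
    [Module R Y'] [Absorbed R W X'] [Absorbed R W Y'] (f : X →ₗ[R] X') (g : Y →ₗ[R] Y') :
    induced W (TensorProduct.map f g) = induced W f * strand R W X (induced W g) := by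
  rw [← LinearMap.rTensor_comp_lTensor, induced_comp, induced_lTensor, induced_rTensor]

@[simp]
theorem induced_assoc : induced W (TensorProduct.assoc R X Y Z).toLinearMap = 1 :=
  end_ext_absorb X fun x => end_ext_absorb Y fun y => end_ext_absorb Z fun z => by
    rw [one_mul, mul_assoc _ (absorb x), ← absorb_tmul, mul_assoc, ← absorb_tmul,
      induced_mul_absorb, LinearEquiv.coe_coe, TensorProduct.assoc_tmul]
    simp only [absorb_tmul, mul_assoc]

@[simp]
theorem induced_lid : induced W (TensorProduct.lid R X).toLinearMap = 1 :=
  end_ext_absorb R fun c => end_ext_absorb X fun x => by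
    rw [mul_assoc, ← absorb_tmul, induced_mul_absorb, LinearEquiv.coe_coe, TensorProduct.lid_tmul,
      map_smul, one_mul, absorb_scalar, smul_one_mul]

@[simp]
theorem induced_rid : induced W (TensorProduct.rid R X).toLinearMap = 1 :=
  end_ext_absorb X fun x => end_ext_absorb R fun c => by
    rw [mul_assoc, ← absorb_tmul, induced_mul_absorb, LinearEquiv.coe_coe, TensorProduct.rid_tmul,
      map_smul, one_mul, absorb_scalar, mul_smul_one]

theorem induced_symm_eq_one {e : X ≃ₗ[R] Y} (h : induced W e.toLinearMap = 1) :
    induced W e.symm.toLinearMap = 1 := by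
  rw [← induced_id (X := Y), ← LinearEquiv.comp_symm e, induced_comp, h, one_mul]

@[simp]
theorem induced_assoc_symm : induced W (TensorProduct.assoc R X Y Z).symm.toLinearMap = 1 :=
  induced_symm_eq_one induced_assoc

@[simp]
theorem induced_lid_symm : induced W (TensorProduct.lid R X).symm.toLinearMap = 1 :=
  induced_symm_eq_one induced_lid

@[simp]
theorem induced_rid_symm : induced W (TensorProduct.rid R X).symm.toLinearMap = 1 :=
  induced_symm_eq_one induced_rid

@[simp]
theorem strand_tensor (u : Module.End R W) :
    strand R W (X ⊗[R] Y) u = strand R W X (strand R W Y u) :=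
  end_ext_absorb X fun x => end_ext_absorb Y fun y => by
    rw [mul_assoc, ← absorb_tmul, strand_mul_absorb, absorb_tmul, strand_mul_absorb, mul_assoc,
      mul_assoc, strand_mul_absorb]

@[simp]
theorem strand_scalar (u : Module.End R W) : strand R W R u = u :=
  end_ext_absorb R fun c => by
    rw [strand_mul_absorb, absorb_scalar, smul_one_mul, mul_smul_one]

instance (f : R →ₗ[R] X) : Local (strand R W X) 0 1 (induced W f) where
  mul_iterate u := by
    have := induced_mul_strand f u
    rwa [strand_scalar] at this

instance (f : X →ₗ[R] R) : Local (strand R W X) 1 0 (induced W f) where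
  mul_iterate u := by
    have := induced_mul_strand f u
    rwa [strand_scalar] at this

instance (f : X →ₗ[R] X) : Local (strand R W X) 1 1 (induced W f) where
  mul_iterate u := induced_mul_strand f u

instance (f : X ⊗[R] X →ₗ[R] X) : Local (strand R W X) 2 1 (induced W f) where
  mul_iterate u := by
    have := induced_mul_strand f u
    rwa [strand_tensor] at this

instance (f : X →ₗ[R] X ⊗[R] X) : Local (strand R W X) 1 2 (induced W f) where
  mul_iterate u := by
    have := induced_mul_strand f u
    rwa [strand_tensor] at this

instance (f : X ⊗[R] X →ₗ[R] X ⊗[R] X) : Local (strand R W X) 2 2 (induced W f) where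
  mul_iterate u := by
    have := induced_mul_strand f u
    rwa [strand_tensor] at this

variable (W X) in
/-- The action of the linear automorphisms of `X` on the reservoir. -/
def inducedUnits : (X ≃ₗ[R] X) →* (Module.End R W)ˣ where
  toFun f :=
    { val := induced W f.toLinearMap
      inv := induced W f.symm.toLinearMap
      val_inv := by rw [← induced_comp, LinearEquiv.comp_symm, induced_id]
      inv_val := by rw [← induced_comp, LinearEquiv.symm_comp, induced_id] }
  map_one' := Units.ext induced_id
  map_mul' f g := Units.ext (induced_comp f.toLinearMap g.toLinearMap)

@[simp]
theorem val_inducedUnits (f : X ≃ₗ[R] X) :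
    (inducedUnits W X f : Module.End R W) = induced W f.toLinearMap := rfl

@[simp]
theorem val_inv_inducedUnits (f : X ≃ₗ[R] X) :
    ((inducedUnits W X f)⁻¹ : (Module.End R W)ˣ) = induced W f.symm.toLinearMap := rfl

end Reservoir

section Faithful

variable {R W X Y : Type*} [CommRing R] [AddCommGroup W] [Module R W] [Module.FaithfullyFlat R W]
  [AddCommGroup X] [Module R X] [AddCommGroup Y] [Module R Y] [Absorbed R W X] [Absorbed R W Y]

variable (W) in
theorem induced_injective : Function.Injective (induced W : (X →ₗ[R] Y) → Module.End R W) := by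
  intro f g h
  have rTensor_eq : f.rTensor W = g.rTensor W := by
    simpa only [induced, LinearMap.cancel_left Absorbed.equiv.injective,
      LinearMap.cancel_right Absorbed.equiv.symm.surjective] using h
  rw [← sub_eq_zero, Module.FaithfullyFlat.zero_iff_rTensor_zero R W, LinearMap.rTensor_sub,
    rTensor_eq, sub_self]

theorem bijective_of_isUnit_induced {f : X →ₗ[R] Y} (h : IsUnit (induced W f)) :
    Function.Bijective f := by
  rw [← Module.FaithfullyFlat.lTensor_bijective_iff_bijective R W,
    LinearMap.lTensor_bij_iff_rTensor_bij]
  simpa [Module.End.isUnit_iff, induced] using h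

end Faithful

theorem exists_faithfullyFlat_absorbed.{u, v} (k : Type u) (A : Type v) [Field k] [AddCommGroup A]
    [Module k A] [Nontrivial A] :
    ∃ (W : Type max u v) (_ : AddCommGroup W) (_ : Module k W) (_ : Absorbed k W A),
      Module.FaithfullyFlat k W := by
  let b := Module.Basis.ofVectorSpace k A
  let ι := Module.Basis.ofVectorSpaceIndex k A
  have : Nonempty ι := b.index_nonempty
  let cons : ι × Stream' ι ≃ Stream' ι :=
    { toFun p := Stream'.cons p.1 p.2
      invFun t := (t.head, t.tail)
      left_inv _ := rfl
      right_inv := Stream'.eta }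
  have : Nonempty (Stream' ι) := (inferInstance : Nonempty ι).map Stream'.const
  let equiv : A ⊗[k] (Stream' ι →₀ k) ≃ₗ[k] (Stream' ι →₀ k) :=
    TensorProduct.congr b.repr (LinearEquiv.refl k _) ≪≫ₗ
      finsuppTensorFinsupp' k ι (Stream' ι) ≪≫ₗ Finsupp.domLCongr cons
  exact ⟨Stream' ι →₀ k, inferInstance, inferInstance, ⟨equiv⟩, inferInstance⟩

section Translation

variable {A W : Type*} [AddCommGroup A] [Module ℂ A] [AddCommGroup W] [Module ℂ W]
  [Absorbed ℂ W A]

@[simp]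
theorem induced_onFirstTwo {V : Type*} [AddCommGroup V] [Module ℂ V] [Absorbed ℂ W V]
    (f : A ⊗[ℂ] A →ₗ[ℂ] A ⊗[ℂ] A) : induced W (onFirstTwo V f) = induced W f := by
  simp [onFirstTwo]

@[simp]
theorem induced_mulLeft (m : A ⊗[ℂ] A →ₗ[ℂ] A) : induced W (mulLeft m) = induced W m := by
  simp [mulLeft]

@[simp]
theorem induced_comulLeft (φ : A →ₗ[ℂ] A ⊗[ℂ] A) : induced W (comulLeft φ) = induced W φ := by
  simp [comulLeft]

@[simp]
theorem induced_onMiddle (f : A ⊗[ℂ] A →ₗ[ℂ] A ⊗[ℂ] A) :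
    induced W (onMiddle f) = strand ℂ W A (induced W f) := by
  simp [onMiddle]

theorem induced_secondaryFlip (φ : A →ₗ[ℂ] A ⊗[ℂ] A) (ε : A →ₗ[ℂ] ℂ)
    (σ : A ⊗[ℂ] A ≃ₗ[ℂ] A ⊗[ℂ] A) :
    induced W (secondaryFlip φ ε σ) = strand ℂ W A (strand ℂ W A (induced W ε)) *
      strand ℂ W A (induced W σ.symm.toLinearMap) * induced W φ * induced W σ.toLinearMap := by
  simp [secondaryFlip, mul_assoc]

theorem one_mul_iff {m : A ⊗[ℂ] A →ₗ[ℂ] A} {one : A} :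
    (∀ a, m (one ⊗ₜ[ℂ] a) = a) ↔ m ∘ₗ (LinearMap.toSpanSingleton ℂ A one).rTensor A ∘ₗ
      (TensorProduct.lid ℂ A).symm.toLinearMap = LinearMap.id := by
  simp [LinearMap.ext_iff]

theorem mul_one_iff {m : A ⊗[ℂ] A →ₗ[ℂ] A} {one : A} :
    (∀ a, m (a ⊗ₜ[ℂ] one) = a) ↔ m ∘ₗ (LinearMap.toSpanSingleton ℂ A one).lTensor A ∘ₗ
      (TensorProduct.rid ℂ A).symm.toLinearMap = LinearMap.id := by
  simp [LinearMap.ext_iff]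

theorem forall_eq_counit_smul_one_iff {f : A →ₗ[ℂ] A} {one : A} {ε : A →ₗ[ℂ] ℂ} :
    (∀ a, f a = ε a • one) ↔ f = LinearMap.toSpanSingleton ℂ A one ∘ₗ ε := by
  simp [LinearMap.ext_iff]

variable {m : A ⊗[ℂ] A →ₗ[ℂ] A} {one : A} {φ : A →ₗ[ℂ] A ⊗[ℂ] A} {ε : A →ₗ[ℂ] ℂ}
  {κ : A →ₗ[ℂ] A} {σ τ : A ⊗[ℂ] A ≃ₗ[ℂ] A ⊗[ℂ] A}

variable (W) in
/-- The strand calculus presentation of a braided quantum group, on a reservoir absorbing `A`. -/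
@[simps]
def IsBraidedQuantumGroup.toStrandGroup (hG : IsBraidedQuantumGroup m one φ ε κ σ) :
    StrandGroup (strand ℂ W A) where
  mul := induced W m
  unit := induced W (LinearMap.toSpanSingleton ℂ A one)
  comul := induced W φ
  counit := induced W ε
  antipode := induced W κ
  braiding := inducedUnits W (A ⊗[ℂ] A) σ
  local_mul := inferInstance
  local_unit := inferInstance
  local_comul := inferInstance
  local_counit := inferInstance
  local_antipode := inferInstance
  local_braiding := inferInstanceAs (Local (strand ℂ W A) 2 2 (induced W σ.toLinearMap))
  mul_mul := by simpa using congrArg (induced W) hG.mul_assoc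
  mul_unit := by simpa using congrArg (induced W) (one_mul_iff.1 hG.one_mul)
  mul_shift_unit := by simpa using congrArg (induced W) (mul_one_iff.1 hG.mul_one)
  comul_comul := by simpa using congrArg (induced W) hG.coassoc
  counit_comul := by simpa using congrArg (induced W) hG.counit_left
  shift_counit_comul := by simpa using congrArg (induced W) hG.counit_right
  braiding_mul := by simpa [_root_.mul_assoc] using congrArg (induced W) hG.braiding_mul_left
  braiding_shift_mul := by simpa [_root_.mul_assoc] using congrArg (induced W) hG.braiding_mul_right
  comul_mul := by simpa [_root_.mul_assoc] using congrArg (induced W) hG.comul_mul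
  braiding_comul := by simpa [_root_.mul_assoc] using congrArg (induced W) hG.braiding_comul
  isUnit_antipode :=
    (inducedUnits W A (LinearEquiv.ofBijective κ hG.antipode_bijective)).isUnit
  mul_shift_antipode_comul := by
    simpa [_root_.mul_assoc] using congrArg (induced W)
      (forall_eq_counit_smul_one_iff (f := m ∘ₗ κ.lTensor A ∘ₗ φ).1 hG.antipode_right)
  mul_antipode_comul := by
    simpa [_root_.mul_assoc] using congrArg (induced W)
      (forall_eq_counit_smul_one_iff (f := m ∘ₗ κ.rTensor A ∘ₗ φ).1 hG.antipode_left)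

theorem isBraidedQuantumGroup_of_strandGroup [Module.FaithfullyFlat ℂ W]
    (H : StrandGroup (strand ℂ W A)) (hm : H.mul = induced W m)
    (hone : H.unit = induced W (LinearMap.toSpanSingleton ℂ A one)) (hφ : H.comul = induced W φ)
    (hε : H.counit = induced W ε) (hκ : H.antipode = induced W κ)
    (hσ : H.braiding = inducedUnits W (A ⊗[ℂ] A) σ) :
    IsBraidedQuantumGroup m one φ ε κ σ where
  mul_assoc := induced_injective W (by simpa [hm] using H.mul_mul)
  one_mul := one_mul_iff.2 (induced_injective W (by simpa [hm, hone] using H.mul_unit))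
  mul_one := mul_one_iff.2 (induced_injective W (by simpa [hm, hone] using H.mul_shift_unit))
  coassoc := induced_injective W (by simpa [hφ] using H.comul_comul)
  counit_left := induced_injective W (by simpa [hφ, hε] using H.counit_comul)
  counit_right := induced_injective W (by simpa [hφ, hε] using H.shift_counit_comul)
  antipode_bijective := bijective_of_isUnit_induced (hκ ▸ H.isUnit_antipode)
  braiding_mul_left := induced_injective W (by simpa [hm, hσ, mul_assoc] using H.braiding_mul)
  braiding_mul_right :=
    induced_injective W (by simpa [hm, hσ, mul_assoc] using H.braiding_shift_mul)
  comul_mul := induced_injective W (by simpa [hm, hφ, hσ, mul_assoc] using H.comul_mul)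
  braiding_comul := induced_injective W (by simpa [hφ, hσ, mul_assoc] using H.braiding_comul)
  antipode_right := (forall_eq_counit_smul_one_iff (f := m ∘ₗ κ.lTensor A ∘ₗ φ)).2 <|
    induced_injective W (by simpa [hm, hφ, hκ, hε, hone, mul_assoc] using
      H.mul_shift_antipode_comul)
  antipode_left := (forall_eq_counit_smul_one_iff (f := m ∘ₗ κ.rTensor A ∘ₗ φ)).2 <|
    induced_injective W (by simpa [hm, hφ, hκ, hε, hone, mul_assoc] using
      H.mul_antipode_comul)

theorem braidingSeq_zero (σ τ : A ⊗[ℂ] A ≃ₗ[ℂ] A ⊗[ℂ] A) : braidingSeq σ τ 0 = τ := by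
  simp [braidingSeq]

namespace IsBraidedQuantumGroup

variable (hG : IsBraidedQuantumGroup m one φ ε κ σ)

include hG

variable (W) in
theorem val_flip_toStrandGroup :
    (hG.toStrandGroup W).flip.val = induced W (secondaryFlip φ ε σ) := by
  rw [StrandGroup.val_flip, induced_secondaryFlip]
  rfl

variable (W) in
theorem exists_flip [Module.FaithfullyFlat ℂ W] :
    ∃ τ : A ⊗[ℂ] A ≃ₗ[ℂ] A ⊗[ℂ] A, τ.toLinearMap = secondaryFlip φ ε σ := by
  have bijective : Function.Bijective (secondaryFlip φ ε σ) :=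
    bijective_of_isUnit_induced (hG.val_flip_toStrandGroup W ▸ Units.isUnit _)
  exact ⟨LinearEquiv.ofBijective _ bijective, rfl⟩

variable (hτ : τ.toLinearMap = secondaryFlip φ ε σ)

include hτ

theorem braidingPow_toStrandGroup (n : ℤ) :
    (hG.toStrandGroup W).braidingPow n = inducedUnits W (A ⊗[ℂ] A) (braidingSeq σ τ n) := by
  have flip_eq : (hG.toStrandGroup W).flip = inducedUnits W (A ⊗[ℂ] A) τ :=
    Units.ext (by rw [val_flip_toStrandGroup, val_inducedUnits, hτ])
  rw [StrandGroup.braidingPow, flip_eq, toStrandGroup_braiding, braidingSeq, map_mul, map_zpow,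
    map_mul, map_inv]

theorem mulPow_toStrandGroup (n : ℤ) :
    (hG.toStrandGroup W).mulPow n = induced W (mulSeq m σ τ n) := by
  rw [StrandGroup.mulPow, hG.braidingPow_toStrandGroup hτ]
  simp only [mulSeq, induced_comp, val_inv_inducedUnits, val_inducedUnits, toStrandGroup_mul,
    toStrandGroup_braiding]

theorem antipode_mul_counitTwist_toStrandGroup (n : ℤ) :
    (hG.toStrandGroup W).antipode * (hG.toStrandGroup W).counitTwist n =
      induced W (antipodeSeq φ ε κ σ τ n) := by
  have exchange : induced W κ * induced W ε = induced W ε * strand ℂ W A (induced W κ) := by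
    rw [induced_mul_strand, strand_scalar]
  rw [StrandGroup.counitTwist, hG.braidingPow_toStrandGroup hτ]
  simp [antipodeSeq, ← _root_.mul_assoc, exchange]

variable (W) in
theorem antipodeSeq_eq_antipodeSeq' [Module.FaithfullyFlat ℂ W] (n : ℤ) :
    antipodeSeq φ ε κ σ τ n = antipodeSeq' φ ε κ σ τ n := by
  apply induced_injective W
  rw [← hG.antipode_mul_counitTwist_toStrandGroup hτ, StrandGroup.counitTwist_eq_shift_counit_mul,
    hG.braidingPow_toStrandGroup hτ]
  simp [antipodeSeq', _root_.mul_assoc]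

variable (W) in
theorem deformation [Module.FaithfullyFlat ℂ W] (n : ℤ) :
    IsBraidedQuantumGroup (mulSeq m σ τ n) one φ ε (antipodeSeq φ ε κ σ τ n)
      (braidingSeq σ τ n) :=
  isBraidedQuantumGroup_of_strandGroup ((hG.toStrandGroup W).deform n)
    (hG.mulPow_toStrandGroup hτ n) rfl rfl rfl (hG.antipode_mul_counitTwist_toStrandGroup hτ n)
    (hG.braidingPow_toStrandGroup hτ n)

variable (W) in
theorem counit_mulSeq_zero [Module.FaithfullyFlat ℂ W] (a b : A) :
    ε (mulSeq m σ τ 0 (a ⊗ₜ[ℂ] b)) = ε a * ε b := by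
  have counit_comp_eq :
      ε ∘ₗ mulSeq m σ τ 0 = ε ∘ₗ (TensorProduct.lid ℂ A).toLinearMap ∘ₗ ε.rTensor A := by
    apply induced_injective W
    simpa [← hG.mulPow_toStrandGroup hτ] using (hG.toStrandGroup W).counit_mul_mulPow_zero
  simpa using LinearMap.congr_fun counit_comp_eq (a ⊗ₜ[ℂ] b)

end IsBraidedQuantumGroup

theorem isBraidedQuantumGroup_of_subsingleton [Subsingleton A] (m : A ⊗[ℂ] A →ₗ[ℂ] A) (one : A)
    (φ : A →ₗ[ℂ] A ⊗[ℂ] A) (ε : A →ₗ[ℂ] ℂ) (κ : A →ₗ[ℂ] A) (σ : A ⊗[ℂ] A ≃ₗ[ℂ] A ⊗[ℂ] A) :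
    IsBraidedQuantumGroup m one φ ε κ σ := by
  have κ_bijective : Function.Bijective κ :=
    ⟨Function.injective_of_subsingleton κ, fun a => ⟨a, Subsingleton.elim _ _⟩⟩
  constructor <;> intros <;> first | exact κ_bijective | exact Subsingleton.elim _ _

end Translation

end BraidedQG

end

theorem mainTheorem5 {A : Type*} [AddCommGroup A] [Module ℂ A]
    (m : A ⊗[ℂ] A →ₗ[ℂ] A) (one : A) (φ : A →ₗ[ℂ] A ⊗[ℂ] A) (ε : A →ₗ[ℂ] ℂ)
    (κ : A →ₗ[ℂ] A) (σ : A ⊗[ℂ] A ≃ₗ[ℂ] A ⊗[ℂ] A)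
    (hG : BraidedQG.IsBraidedQuantumGroup m one φ ε κ σ) :
    ∃ τ : A ⊗[ℂ] A ≃ₗ[ℂ] A ⊗[ℂ] A,
      τ.toLinearMap = BraidedQG.secondaryFlip φ ε σ ∧
      (∀ n : ℤ,
        BraidedQG.antipodeSeq φ ε κ σ τ n = BraidedQG.antipodeSeq' φ ε κ σ τ n ∧
        BraidedQG.IsBraidedQuantumGroup (BraidedQG.mulSeq m σ τ n) one φ ε
          (BraidedQG.antipodeSeq φ ε κ σ τ n) (BraidedQG.braidingSeq σ τ n)) ∧
      BraidedQG.braidingSeq σ τ 0 = τ ∧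
      ∀ a b : A, ε (BraidedQG.mulSeq m σ τ 0 (a ⊗ₜ[ℂ] b)) = ε a * ε b := by
  rcases subsingleton_or_nontrivial A with _ | _
  · exact ⟨1, Subsingleton.elim _ _,
      fun n => ⟨Subsingleton.elim _ _, BraidedQG.isBraidedQuantumGroup_of_subsingleton ..⟩,
      BraidedQG.braidingSeq_zero σ 1, fun a b => by simp [Subsingleton.elim a 0]⟩
  · obtain ⟨W, _, _, _, _⟩ := BraidedQG.exists_faithfullyFlat_absorbed ℂ A
    obtain ⟨τ, hτ⟩ := hG.exists_flip W
    exact ⟨τ, hτ, fun n => ⟨hG.antipodeSeq_eq_antipodeSeq' W hτ n, hG.deformation W hτ n⟩,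
      BraidedQG.braidingSeq_zero σ τ, hG.counit_mulSeq_zero W hτ⟩
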